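/- **Definitions.** A *quasi-vertex operator algebra* (QVOA) over $\mathbf C$ is a quadruple $(V,Y,\mathbf 1,\rho)$ as follows. * $V$ is a complex vector space, $\mathbf 1\in V$ is a nonzero vector, and $Y\colon a\mapsto Y(a,z)=\sum_{n\in\mathbf Z}a(n)z^{-n-1}$ is a linear map from $V$ to the fields on $V$ (so $a(n)\in\mathrm{End}(V)$, and for all $a,b\in V$ one has $a(n)b=0$ for $n\gg0$), with $a(n)\mathbf 1=0$ for $n\ge 0$, $a(-1)\mathbf 1=a$, and, for all $a,b,c\in V$ and $r,s,t\in\mathbf Z$, $$\sum_{i\ge0}\binom ri (a(t+i)b)(r+s-i)c=\sum_{i\ge0}(-1)^i\binom ti\bigl\{a(r+t-i)b(s+i)c-(-1)^t\,b(s+t-i)a(r+i)c\bigr\}.$$ * $V=\bigoplus_{k\in\mathbf Z}V_k$ with $\dim V_k<\infty$, $V_k=0$ for $k\ll0$, and $a(n)b\in V_{k+\ell-n-1}$ for $a\in V_k$, $b\in V_\ell$. * $\rho\colon\mathfrak{sl}_2(\mathbf C)\to\mathrm{End}(V)$ is a Lie algebra representation with $\begin{pmatrix}1/2&0\\0&-1/2\end{pmatrix}\mapsto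 L(0)$, $\begin{pmatrix}0&1\\0&0\end{pmatrix}\mapsto L(-1)$, $\begin{pmatrix}0&0\\-1&0\end{pmatrix}\mapsto L(1)$, where $L(0)a=ka$ for $a\in V_k$ and $L(-1)a=a(-2)\mathbf 1$. * For all $n\in\mathbf Z$ one has $(L(-1)a)(n)=-n\,a(n-1)=[L(-1),a(n)]$ for $a\in V$, and $[L(1),a(n)]=(L(1)a)(n)+(2k-n-2)a(n+1)$ for $a\in V_k$. $V$ is *of CFT-type* if $V_0=\mathbf C\mathbf 1$. Put $\dim_qV=\sum_n\dim V_n\,q^n$, a formal Laurent series, and $F_NV=\bigoplus_{n\le N}V_n$, a finite-dimensional space. Let $\mathcal H$ be the complex upper half-plane and $\Gamma=\mathrm{SL}_2(\mathbf Z)$. For $\gamma=\begin{pmatrix}a&b\\c&d\end{pmatrix}\in\Gamma$ and $\tau\in\mathcal H$ put $j(\gamma,\tau)=c\tau+d$, $X(\gamma,\tau)=\frac{c}{c\tau+d}$, and $K(\gamma,\tau)=\exp(-c\,j(\gamma,\tau)L(1))\,j(\gamma,\tau)^{-2L(0)}\in\mathrm{End}(V)$, which is invertible. For $f\colon\mathcal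 H\to V$ and $k\in\mathbf Z$ put $(f\|_k\gamma)(\tau)=j(\gamma,\tau)^{-k}K(\gamma,\tau)^{-1}f(\gamma\tau)$. Call $f$ *holomorphic, also at the cusp*, if for some $N$ it is a holomorphic map $\mathcal H\to F_NV$ given on $\mathcal H$ by a convergent expansion $f(\tau)=\sum_{n\ge0}c_ne^{2\pi in\tau}$ with $c_n\in F_NV$. * $M_k(V)$ is the space of all $f$ that are holomorphic, also at the cusp, and satisfy $f\|_k\gamma=f$ for all $\gamma\in\Gamma$ (holomorphic $V$-valued modular forms of weight $k$). * $Q_k(V)$ is the space of all $f$ that are holomorphic, also at the cusp, and for which there are $s\ge0$ and maps $Q_0(f),\dots,Q_s(f)\colon\mathcal H\to V$, also holomorphic, including at the cusp, with $(f\|_k\gamma)(\tau)=\sum_{n=0}^sX(\gamma,\tau)^nQ_n(f)(\tau)$ for all $\gamma\in\Gamma$, $\tau\in\mathcal H$ (holomorphic $V$-valued quasi-modular forms of weight $k$). **Lemma.** Let $V$ be a QVOA of CFT-type. Then $Q_{2k}(V)$ and $M_{2k}(V)$ are finite-dimensional for all $k\ge0$, and, as formal Laurent series in $q$, $$\sum_{k\ge0}\dim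 Q_{2k}(V)\,q^k=\frac{\dim_qV}{(1-q)(1-q^2)(1-q^3)},\qquad \sum_{k\ge0}\dim M_{2k}(V)\,q^k=\frac{\dim_qV}{(1-q^2)(1-q^3)}.$$ Consequently $(\dim M_{2k}(V))_{k\ge0}$ is the first difference sequence of $(\dim Q_{2k}(V))_{k\ge0}$: $\dim M_0(V)=\dim Q_0(V)$ and $\dim M_{2k+2}(V)=\dim Q_{2k+2}(V)-\dim Q_{2k}(V)$ for all $k\ge0$. -/

import Mathlib

noncomputable section

open VertexOperator (ncoeff)

attribute [local instance] LieRing.ofAssociativeRing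

/-! ### Vertex algebras -/

/-- A vertex algebra over `ℂ` on the Fock space `V`. Mathlib's `VertexOperator ℂ V` is the space of
fields on `V` (for each `b` the series `a(z) b` has only finitely many negative powers of `z`), and
`ncoeff` extracts the mode `a(n)` of `a(z) = ∑ a(n) z ^ (-n-1)`. The sums in the Jacobi identity are
finite, because `Y a` and `Y b` are fields. -/
structure VertexAlgebra (V : Type*) [AddCommGroup V] [Module ℂ V] where
  /-- the vacuum state -/
  vac : V
  vac_ne_zero : vac ≠ 0
  /-- the state-field correspondence -/
  Y : V →ₗ[ℂ] VertexOperator ℂ V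
  creative : ∀ (a : V) (n : ℤ), 0 ≤ n → ncoeff (Y a) n vac = 0
  creates : ∀ a : V, ncoeff (Y a) (-1) vac = a
  jacobi : ∀ (a b c : V) (r s t : ℤ),
    (∑ᶠ i : ℕ, ((Ring.choose r i : ℤ) : ℂ) • ncoeff (Y (ncoeff (Y a) (t + i) b)) (r + s - i) c) =
      ∑ᶠ i : ℕ, ((-1 : ℂ) ^ i * ((Ring.choose t i : ℤ) : ℂ)) •
        (ncoeff (Y a) (r + t - i) (ncoeff (Y b) (s + i) c)
          - (-1 : ℂ) ^ t • ncoeff (Y b) (s + t - i) (ncoeff (Y a) (r + i) c))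

/-- The canonical derivation `D a = a(-2) 𝟏`. -/
def VertexAlgebra.D {V : Type*} [AddCommGroup V] [Module ℂ V] (A : VertexAlgebra V) :
    Module.End ℂ V where
  toFun a := ncoeff (A.Y a) (-2) A.vac
  map_add' a b := by simp
  map_smul' c a := by simp

/-- A `ℤ`-graded vertex algebra: the homogeneous spaces `V_k = deg k` are finite-dimensional and
vanish for `k ≪ 0`. -/
structure GradedVertexAlgebra (V : Type*) [AddCommGroup V] [Module ℂ V]
    extends VertexAlgebra V where
  /-- the space of states of conformal degree `k` -/
  deg : ℤ → Submodule ℂ V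
  internal : DirectSum.IsInternal deg
  mode_mem : ∀ (k l n : ℤ) (a b : V), a ∈ deg k → b ∈ deg l → ncoeff (Y a) n b ∈ deg (k + l - n - 1)
  finiteDimensional : ∀ k, FiniteDimensional ℂ (deg k)
  bounded_below : ∃ N : ℤ, ∀ k < N, deg k = ⊥

namespace GradedVertexAlgebra

variable {V : Type*} [AddCommGroup V] [Module ℂ V] (A : GradedVertexAlgebra V)

/-- The decomposition of a state into its homogeneous components. -/
def decomp : V ≃ₗ[ℂ] DirectSum ℤ fun k => A.deg k :=
  (LinearEquiv.ofBijective (DirectSum.coeLinearMap A.deg) A.internal).symm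

/-- The diagonal operator that multiplies `V_k` by the scalar `c k`. -/
def diag (c : ℤ → ℂ) : Module.End ℂ V :=
  (DirectSum.toModule ℂ ℤ V fun k => c k • (A.deg k).subtype) ∘ₗ A.decomp.toLinearMap

/-- The Euler operator, `E a = k a` for `a ∈ V_k`. -/
def euler : Module.End ℂ V := A.diag fun k => (k : ℂ)

/-- The truncation `F_N V = ⨁_{n ≤ N} V_n`. -/
def trunc (N : ℤ) : Submodule ℂ V := ⨆ n : {n : ℤ // n ≤ N}, A.deg n

/-- The graded dimension `dim_q V = ∑ dim V_n q ^ n`, a formal Laurent series. -/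
def gradedDim : LaurentSeries ℚ :=
  HahnSeries.ofSuppBddBelow (fun n : ℤ => (Module.finrank ℂ (A.deg n) : ℚ)) <| by
    obtain ⟨N, hN⟩ := A.bounded_below
    refine ⟨N, fun n hn => ?_⟩
    by_contra h
    refine hn ?_
    beta_reduce
    rw [hN n (not_le.mp h), finrank_bot, Nat.cast_zero]

theorem decomp_symm_lof {k : ℤ} (a : A.deg k) :
    A.decomp.symm (DirectSum.lof ℂ ℤ (fun i => A.deg i) k a) = a :=
  DirectSum.coeLinearMap_lof _ _ _

theorem decomp_of_mem {k : ℤ} {a : V} (ha : a ∈ A.deg k) :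
    A.decomp a = DirectSum.lof ℂ ℤ (fun i => A.deg i) k ⟨a, ha⟩ := by
  rw [← LinearEquiv.eq_symm_apply, decomp_symm_lof]

theorem diag_apply (c : ℤ → ℂ) {k : ℤ} {a : V} (ha : a ∈ A.deg k) : A.diag c a = c k • a := by
  rw [diag, LinearMap.comp_apply, LinearEquiv.coe_coe, A.decomp_of_mem ha, DirectSum.toModule_lof]
  rfl

theorem span_deg (a : V) : a ∈ ⨆ k, A.deg k := by
  rw [A.internal.submodule_iSup_eq_top]; trivial

theorem end_ext {f g : Module.End ℂ V} (h : ∀ k, ∀ a ∈ A.deg k, f a = g a) : f = g := by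
  ext a
  refine Submodule.iSup_induction A.deg (motive := fun a => f a = g a) (A.span_deg a) h ?_ ?_
  · simp
  · intro x y hx hy; simp [hx, hy]

theorem diag_mul (c d : ℤ → ℂ) : A.diag c * A.diag d = A.diag (fun k => c k * d k) := by
  refine A.end_ext fun k a ha => ?_
  rw [Module.End.mul_apply, A.diag_apply d ha, map_smul, A.diag_apply c ha, A.diag_apply _ ha,
    smul_smul, mul_comm]

theorem diag_one : A.diag (fun _ => 1) = 1 :=
  A.end_ext fun k a ha => by simp [A.diag_apply _ ha]

/-- An eigenvector of the Euler operator is homogeneous. -/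
theorem mem_deg_of_euler {k : ℤ} {a : V} (h : A.euler a = (k : ℂ) • a) : a ∈ A.deg k := by
  have key : ∀ (b : V) (l : ℤ), A.decomp (A.euler b) l = (l : ℂ) • A.decomp b l := by
    intro b l
    refine Submodule.iSup_induction A.deg
      (motive := fun b => A.decomp (A.euler b) l = (l : ℂ) • A.decomp b l) (A.span_deg b) ?_ ?_ ?_
    · intro m b hb
      rw [euler, A.diag_apply _ hb, map_smul, A.decomp_of_mem hb, DirectSum.smul_apply]
      by_cases hm : m = l
      · subst hm; rfl
      · have h0 : DirectSum.lof ℂ ℤ (fun i => A.deg i) m ⟨b, hb⟩ l = 0 :=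
          DirectSum.of_eq_of_ne _ _ _ (Ne.symm hm)
        rw [h0, smul_zero, smul_zero]
    · simp
    · intro x y hx hy
      rw [map_add, map_add, map_add, DirectSum.add_apply, DirectSum.add_apply, hx, hy, smul_add]
  have hz : ∀ l, l ≠ k → A.decomp a l = 0 := by
    intro l hl
    have h1 := key a l
    rw [h, map_smul, DirectSum.smul_apply] at h1
    have h2 : ((k : ℂ) - l) • A.decomp a l = 0 := by rw [sub_smul, h1, sub_self]
    rcases smul_eq_zero.mp h2 with h3 | h3
    · exact absurd (by exact_mod_cast (sub_eq_zero.mp h3).symm) hl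
    · exact h3
  have hs : A.decomp a = DirectSum.lof ℂ ℤ (fun i => A.deg i) k (A.decomp a k) := by
    refine DFinsupp.ext fun l => ?_
    by_cases hl : l = k
    · subst hl
      exact (DirectSum.of_eq_same (β := fun i => A.deg i) l (A.decomp a l)).symm
    · refine (hz l hl).trans ?_
      exact (DirectSum.of_eq_of_ne (β := fun i => A.deg i) k l (A.decomp a k) hl).symm
  rw [← LinearEquiv.eq_symm_apply, decomp_symm_lof] at hs
  rw [hs]
  exact (A.decomp a k).2

end GradedVertexAlgebra

/-! ### Quasi-vertex operator algebras -/

/-- The matrix `[[1/2, 0], [0, -1/2]]` of `𝔰𝔩₂`. -/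
def sl2Zero : LieAlgebra.SpecialLinear.sl (Fin 2) ℂ :=
  ⟨!![1/2, 0; 0, -(1/2)], by simp [LieAlgebra.SpecialLinear.sl, Matrix.trace_fin_two]⟩

/-- The matrix `[[0, 1], [0, 0]]` of `𝔰𝔩₂`. -/
def sl2Raise : LieAlgebra.SpecialLinear.sl (Fin 2) ℂ :=
  ⟨!![0, 1; 0, 0], by simp [LieAlgebra.SpecialLinear.sl, Matrix.trace_fin_two]⟩

/-- The matrix `[[0, 0], [-1, 0]]` of `𝔰𝔩₂`. -/
def sl2Lower : LieAlgebra.SpecialLinear.sl (Fin 2) ℂ :=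
  ⟨!![0, 0; -1, 0], by simp [LieAlgebra.SpecialLinear.sl, Matrix.trace_fin_two]⟩

/-- A quasi-vertex operator algebra. -/
structure QVOA (V : Type*) [AddCommGroup V] [Module ℂ V] extends GradedVertexAlgebra V where
  /-- the representation of `𝔰𝔩₂` on the Fock space -/
  rho : LieAlgebra.SpecialLinear.sl (Fin 2) ℂ →ₗ⁅ℂ⁆ Module.End ℂ V
  rho_zero : rho sl2Zero = toGradedVertexAlgebra.euler
  rho_raise : rho sl2Raise = toVertexAlgebra.D
  translation : ∀ (a : V) (n : ℤ), ncoeff (Y (toVertexAlgebra.D a)) n = -(n : ℂ) • ncoeff (Y a) (n - 1)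
  translation_comm : ∀ (a : V) (n : ℤ),
    ncoeff (Y (toVertexAlgebra.D a)) n = ⁅toVertexAlgebra.D, ncoeff (Y a) n⁆
  lowering_comm : ∀ (k : ℤ), ∀ a ∈ deg k, ∀ n : ℤ,
    ⁅rho sl2Lower, ncoeff (Y a) n⁆ =
      ncoeff (Y (rho sl2Lower a)) n + (2 * k - n - 2 : ℂ) • ncoeff (Y a) (n + 1)

namespace QVOA

variable {V : Type*} [AddCommGroup V] [Module ℂ V] (A : QVOA V)

/-- `V` is of CFT-type if `V_0 = ℂ 𝟏`. -/
def IsCFTType : Prop := A.deg 0 = Submodule.span ℂ {A.vac}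

/-- The lowering operator `L(1)`. -/
def L1 : Module.End ℂ V := A.rho sl2Lower

theorem L1_mem {k : ℤ} {a : V} (ha : a ∈ A.deg k) : A.L1 a ∈ A.deg (k - 1) := by
  have hb : ⁅sl2Zero, sl2Lower⁆ = -sl2Lower := by
    apply Subtype.ext
    rw [LieAlgebra.SpecialLinear.sl_bracket]
    ext i j
    fin_cases i <;> fin_cases j <;> norm_num [sl2Zero, sl2Lower]
  have h := A.rho.map_lie sl2Zero sl2Lower
  rw [hb, map_neg, A.rho_zero] at h
  have h2 := LinearMap.congr_fun h a
  simp only [LinearMap.neg_apply, Ring.lie_def, LinearMap.sub_apply, Module.End.mul_apply] at h2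
  have h3 : A.euler a = (k : ℂ) • a := A.diag_apply _ ha
  refine A.mem_deg_of_euler ?_
  rw [h3, map_smul] at h2
  change A.euler (A.rho sl2Lower a) = _
  rw [sub_eq_iff_eq_add.mp h2.symm]
  push_cast
  rw [sub_smul, one_smul]
  change _ = (k : ℂ) • A.rho sl2Lower a - A.rho sl2Lower a
  abel

/-- `L(1)` is locally nilpotent. -/
theorem L1_locallyNilpotent (a : V) : ∃ m : ℕ, ∀ n ≥ m, (A.L1 ^ n) a = 0 := by
  obtain ⟨N, hN⟩ := A.bounded_below
  refine Submodule.iSup_induction A.deg (motive := fun a => ∃ m : ℕ, ∀ n ≥ m, (A.L1 ^ n) a = 0)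
    (A.span_deg a) ?_ ⟨0, by simp⟩ ?_
  · intro k a ha
    have hmem : ∀ n : ℕ, (A.L1 ^ n) a ∈ A.deg (k - n) := by
      intro n
      induction n with
      | zero => simpa using ha
      | succ n ih =>
        rw [pow_succ', Module.End.mul_apply]
        have := A.L1_mem ih
        rwa [show k - ((n + 1 : ℕ) : ℤ) = k - n - 1 by push_cast; ring]
    refine ⟨(k - N + 1).toNat, fun n hn => ?_⟩
    have h := hmem n
    rw [hN (k - n) (by omega)] at h
    simpa using h
  · rintro x y ⟨m, hm⟩ ⟨m', hm'⟩
    refine ⟨max m m', fun n hn => ?_⟩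
    rw [map_add, hm n (le_trans (le_max_left _ _) hn), hm' n (le_trans (le_max_right _ _) hn),
      add_zero]

theorem finite_support_expL1 (t : ℂ) (a : V) :
    (Function.support fun n : ℕ => (t ^ n / (n.factorial : ℂ)) • (A.L1 ^ n) a).Finite := by
  obtain ⟨m, hm⟩ := A.L1_locallyNilpotent a
  refine (Set.finite_lt_nat m).subset fun n hn => ?_
  by_contra h
  exact hn (by simp [hm n (not_lt.mp h)])

/-- The operator `exp (t L(1))`; on each state the exponential series is a finite sum. -/
def expL1 (t : ℂ) : Module.End ℂ V where
  toFun a := ∑ᶠ n : ℕ, (t ^ n / (n.factorial : ℂ)) • (A.L1 ^ n) a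
  map_add' a b := by
    rw [← finsum_add_distrib (A.finite_support_expL1 t a) (A.finite_support_expL1 t b)]
    simp
  map_smul' c a := by
    rw [RingHom.id_apply, smul_finsum' c (A.finite_support_expL1 t a)]
    simp [smul_comm c]

theorem expL1_eq_aeval (t : ℂ) {a : V} {m : ℕ} (hm : ∀ n ≥ m, (A.L1 ^ n) a = 0) :
    A.expL1 t a = Polynomial.aeval A.L1
      (PowerSeries.trunc m (PowerSeries.rescale t (PowerSeries.exp ℂ))) a := by
  have h1 : A.expL1 t a =
      ∑ n ∈ Finset.range m, (t ^ n / (n.factorial : ℂ)) • (A.L1 ^ n) a := by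
    refine finsum_eq_sum_of_support_subset _ fun n hn => ?_
    simp only [Finset.coe_range, Set.mem_Iio]
    by_contra h
    exact hn (by simp [hm n (not_lt.mp h)])
  rw [h1, PowerSeries.trunc_apply, map_sum, LinearMap.sum_apply, Nat.Ico_zero_eq_range]
  refine Finset.sum_congr rfl fun n _ => ?_
  rw [Polynomial.aeval_monomial]
  simp [PowerSeries.coeff_rescale, PowerSeries.coeff_exp, div_eq_mul_inv, Algebra.algebraMap_eq_smul_one]

theorem expL1_mul (s t : ℂ) : A.expL1 s * A.expL1 t = A.expL1 (s + t) := by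
  ext a
  obtain ⟨m, hm⟩ := A.L1_locallyNilpotent a
  set F := PowerSeries.rescale s (PowerSeries.exp ℂ)
  set G := PowerSeries.rescale t (PowerSeries.exp ℂ)
  have hz : ∀ p : Polynomial ℂ, Polynomial.X ^ m ∣ p → Polynomial.aeval A.L1 p a = 0 := by
    rintro p ⟨r, rfl⟩
    rw [mul_comm, map_mul, map_pow, Polynomial.aeval_X, Module.End.mul_apply, hm m le_rfl, map_zero]
  have hm' : ∀ p : Polynomial ℂ, ∀ n ≥ m, (A.L1 ^ n) (Polynomial.aeval A.L1 p a) = 0 := by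
    intro p n hn
    rw [← Polynomial.aeval_X_pow (R := ℂ) A.L1, ← Module.End.mul_apply, ← map_mul, mul_comm,
      map_mul, Module.End.mul_apply, Polynomial.aeval_X_pow, hm n hn, map_zero]
  rw [Module.End.mul_apply, A.expL1_eq_aeval t hm, A.expL1_eq_aeval s (hm' _),
    A.expL1_eq_aeval (s + t) hm, ← PowerSeries.exp_mul_exp_eq_exp_add,
    ← Module.End.mul_apply, ← map_mul, ← sub_eq_zero, ← LinearMap.sub_apply, ← map_sub]
  refine hz _ (Polynomial.X_pow_dvd_iff.mpr fun d hd => ?_)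
  rw [Polynomial.coeff_sub, ← PowerSeries.trunc_trunc_mul_trunc, PowerSeries.coeff_trunc, if_pos hd,
    ← Polynomial.coe_mul, Polynomial.coeff_coe, sub_self]

theorem expL1_zero : A.expL1 0 = 1 := by
  ext a
  change (∑ᶠ n : ℕ, ((0 : ℂ) ^ n / (n.factorial : ℂ)) • (A.L1 ^ n) a) = a
  rw [finsum_eq_single _ 0 (fun n hn => by simp [hn])]
  simp

end QVOA

/-! ### The action of the modular group -/

/-- The factor of automorphy `j(γ, τ) = c τ + d`. -/
def autFactor (γ : Matrix.SpecialLinearGroup (Fin 2) ℤ) (τ : UpperHalfPlane) : ℂ :=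
  (γ 1 0 : ℂ) * (τ : ℂ) + (γ 1 1 : ℂ)

/-- The function `X(γ, τ) = c / (c τ + d)`. -/
def autX (γ : Matrix.SpecialLinearGroup (Fin 2) ℤ) (τ : UpperHalfPlane) : ℂ :=
  (γ 1 0 : ℂ) / autFactor γ τ

theorem autFactor_ne_zero (γ : Matrix.SpecialLinearGroup (Fin 2) ℤ) (τ : UpperHalfPlane) :
    autFactor γ τ ≠ 0 := by
  intro h
  have him := congrArg Complex.im h
  have hre := congrArg Complex.re h
  simp [autFactor] at him hre
  have hc : γ 1 0 = 0 := by
    rcases him with h | h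
    · exact h
    · exact absurd h τ.im_pos.ne'
  rw [hc] at hre
  have hd : γ 1 1 = 0 := by simpa using hre
  have hdet := γ.det_coe
  rw [Matrix.det_fin_two] at hdet
  simp [hc, hd] at hdet

namespace QVOA

variable {V : Type*} [AddCommGroup V] [Module ℂ V] (A : QVOA V)

/-- The canonical cocycle `K(γ, τ) = exp (-c j(γ, τ) L(1)) j(γ, τ) ^ (-2 L(0))`, as an invertible
operator on `V`; its inverse is `j(γ, τ) ^ (2 L(0)) exp (c j(γ, τ) L(1))`. -/
def K (γ : Matrix.SpecialLinearGroup (Fin 2) ℤ) (τ : UpperHalfPlane) : (Module.End ℂ V)ˣ where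
  val := A.expL1 (-((γ 1 0 : ℂ) * autFactor γ τ)) * A.diag fun n => autFactor γ τ ^ (-2 * n)
  inv := (A.diag fun n => autFactor γ τ ^ (2 * n)) * A.expL1 ((γ 1 0 : ℂ) * autFactor γ τ)
  val_inv := by
    have h : (fun n : ℤ => autFactor γ τ ^ (-2 * n) * autFactor γ τ ^ (2 * n)) = fun _ => 1 := by
      funext n
      rw [← zpow_add₀ (autFactor_ne_zero γ τ)]
      simp
    rw [mul_assoc, ← mul_assoc (A.diag _), A.diag_mul, h, A.diag_one, one_mul, A.expL1_mul,
      neg_add_cancel, A.expL1_zero]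
  inv_val := by
    have h : (fun n : ℤ => autFactor γ τ ^ (2 * n) * autFactor γ τ ^ (-2 * n)) = fun _ => 1 := by
      funext n
      rw [← zpow_add₀ (autFactor_ne_zero γ τ)]
      simp
    rw [mul_assoc, ← mul_assoc (A.expL1 _), A.expL1_mul, add_neg_cancel, A.expL1_zero, one_mul,
      A.diag_mul, h, A.diag_one]

/-- The slash operator `(f ‖_k γ)(τ) = j(γ, τ) ^ (-k) K(γ, τ)⁻¹ f(γ τ)`. -/
def slash (k : ℤ) (f : UpperHalfPlane → V) (γ : Matrix.SpecialLinearGroup (Fin 2) ℤ)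
    (τ : UpperHalfPlane) : V :=
  autFactor γ τ ^ (-k) • ((A.K γ τ)⁻¹ : (Module.End ℂ V)ˣ).val (f (γ • τ))

theorem slash_add (k : ℤ) (f g : UpperHalfPlane → V) (γ : Matrix.SpecialLinearGroup (Fin 2) ℤ)
    (τ : UpperHalfPlane) : A.slash k (f + g) γ τ = A.slash k f γ τ + A.slash k g γ τ := by
  simp [slash]

theorem slash_smul (k : ℤ) (c : ℂ) (f : UpperHalfPlane → V)
    (γ : Matrix.SpecialLinearGroup (Fin 2) ℤ) (τ : UpperHalfPlane) :
    A.slash k (c • f) γ τ = c • A.slash k f γ τ := by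
  simp [slash, smul_comm c]

theorem slash_zero (k : ℤ) (γ : Matrix.SpecialLinearGroup (Fin 2) ℤ) (τ : UpperHalfPlane) :
    A.slash k 0 γ τ = 0 := by
  simp [slash]

/-! ### Modular and quasi-modular forms with values in `V` -/

/-- `f` is a holomorphic map from the upper half-plane to `F_N V`, with a holomorphic `q`-expansion
in `F_N V ⟦q⟧`, where `q = exp (2 π i τ)`. As `F_N V` is finite-dimensional, holomorphy and the
convergence of a series in `F_N V` are tested on linear functionals (equivalently, on the
coordinates in a basis). -/
structure IsHolomorphicForm (N : ℤ) (f : UpperHalfPlane → V) : Prop where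
  mem_trunc : ∀ τ, f τ ∈ A.trunc N
  holomorphic : ∀ φ : Module.Dual ℂ V,
    MDifferentiable (modelWithCornersSelf ℂ ℂ) (modelWithCornersSelf ℂ ℂ) fun τ => φ (f τ)
  holomorphicAtCusp : ∃ c : ℕ → V, (∀ n, c n ∈ A.trunc N) ∧
    ∀ (φ : Module.Dual ℂ V) (τ : UpperHalfPlane),
      HasSum (fun n => φ (c n) * Function.Periodic.qParam 1 (τ : ℂ) ^ n) (φ (f τ))

variable {A}

theorem trunc_mono {N N' : ℤ} (h : N ≤ N') : A.trunc N ≤ A.trunc N' :=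
  iSup_le fun n => le_iSup (fun m : {m : ℤ // m ≤ N'} => A.deg m) ⟨n.1, n.2.trans h⟩

theorem IsHolomorphicForm.mono {N N' : ℤ} {f : UpperHalfPlane → V}
    (hf : A.IsHolomorphicForm N f) (h : N ≤ N') : A.IsHolomorphicForm N' f := by
  obtain ⟨c, hc, hs⟩ := hf.holomorphicAtCusp
  exact ⟨fun τ => trunc_mono h (hf.mem_trunc τ), hf.holomorphic,
    c, fun n => trunc_mono h (hc n), hs⟩

theorem IsHolomorphicForm.add {N : ℤ} {f g : UpperHalfPlane → V}
    (hf : A.IsHolomorphicForm N f) (hg : A.IsHolomorphicForm N g) :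
    A.IsHolomorphicForm N (f + g) := by
  obtain ⟨c, hc, hs⟩ := hf.holomorphicAtCusp
  obtain ⟨d, hd, ht⟩ := hg.holomorphicAtCusp
  refine ⟨fun τ => add_mem (hf.mem_trunc τ) (hg.mem_trunc τ), fun φ => ?_,
    c + d, fun n => add_mem (hc n) (hd n), fun φ τ => ?_⟩
  · have := (hf.holomorphic φ).add (hg.holomorphic φ)
    convert this using 1
    funext τ; simp
  · have := (hs φ τ).add (ht φ τ)
    simpa [add_mul] using this

theorem IsHolomorphicForm.smul {N : ℤ} {f : UpperHalfPlane → V} (a : ℂ)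
    (hf : A.IsHolomorphicForm N f) : A.IsHolomorphicForm N (a • f) := by
  obtain ⟨c, hc, hs⟩ := hf.holomorphicAtCusp
  refine ⟨fun τ => Submodule.smul_mem _ a (hf.mem_trunc τ), fun φ => ?_,
    a • c, fun n => Submodule.smul_mem _ a (hc n), fun φ τ => ?_⟩
  · have := (hf.holomorphic φ).const_smul a
    convert this using 1
    funext τ; simp
  · have := (hs φ τ).mul_left a
    simpa [mul_assoc] using this

theorem IsHolomorphicForm.zero (N : ℤ) : A.IsHolomorphicForm N (0 : UpperHalfPlane → V) := by
  refine ⟨fun τ => zero_mem _, fun φ => ?_, 0, fun n => zero_mem _, fun φ τ => ?_⟩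
  · simp [mdifferentiable_const]
  · simp [hasSum_zero]

variable (A)

/-- The space `M_k(V)` of holomorphic `V`-valued modular forms of weight `k`. -/
def modularForms (k : ℤ) : Submodule ℂ (UpperHalfPlane → V) where
  carrier := {f | (∃ N, A.IsHolomorphicForm N f) ∧ ∀ γ τ, A.slash k f γ τ = f τ}
  zero_mem' := ⟨⟨0, .zero 0⟩, fun γ τ => A.slash_zero k γ τ⟩
  add_mem' := by
    rintro f g ⟨⟨N, hf⟩, hf'⟩ ⟨⟨N', hg⟩, hg'⟩
    refine ⟨⟨max N N', (hf.mono (le_max_left _ _)).add (hg.mono (le_max_right _ _))⟩, fun γ τ => ?_⟩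
    rw [slash_add, hf', hg', Pi.add_apply]
  smul_mem' := by
    rintro c f ⟨⟨N, hf⟩, hf'⟩
    refine ⟨⟨N, hf.smul c⟩, fun γ τ => ?_⟩
    rw [slash_smul, hf', Pi.smul_apply]

/-- `f` is a holomorphic `V`-valued quasi-modular form of weight `k` and depth at most `s`, with
coefficient functions `Q 0, …, Q s`: one has `f ‖_k γ = ∑_{n ≤ s} X(γ, τ) ^ n Q_n` for all `γ`,
and `f` and the `Q_n` are holomorphic, also at the cusp. -/
structure IsQuasiModular (k : ℤ) (s : ℕ) (N : ℤ) (f : UpperHalfPlane → V)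
    (Q : ℕ → UpperHalfPlane → V) : Prop where
  form : A.IsHolomorphicForm N f
  coeff : ∀ n ≤ s, A.IsHolomorphicForm N (Q n)
  slash_eq : ∀ γ τ, A.slash k f γ τ = ∑ n ∈ Finset.range (s + 1), autX γ τ ^ n • Q n τ

variable {A} in
theorem IsQuasiModular.mono {k : ℤ} {s s' : ℕ} {N N' : ℤ} {f : UpperHalfPlane → V}
    {Q : ℕ → UpperHalfPlane → V} (h : A.IsQuasiModular k s N f Q) (hs : s ≤ s') (hN : N ≤ N') :
    A.IsQuasiModular k s' N' f (fun n => if n ≤ s then Q n else 0) where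
  form := h.form.mono hN
  coeff n _ := by
    split_ifs with hn
    · exact (h.coeff n hn).mono hN
    · exact .zero N'
  slash_eq γ τ := by
    rw [h.slash_eq]
    rw [← Finset.sum_subset (Finset.range_mono (Nat.add_le_add_right hs 1))]
    · refine Finset.sum_congr rfl fun n hn => ?_
      rw [if_pos (Nat.lt_succ_iff.mp (Finset.mem_range.mp hn))]
    · intro n _ hn
      rw [if_neg (fun h' => hn (Finset.mem_range.mpr (Nat.lt_succ_of_le h')))]
      simp

/-- The space `Q_k(V)` of holomorphic `V`-valued quasi-modular forms of weight `k`, of any depth. -/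
def quasiModularForms (k : ℤ) : Submodule ℂ (UpperHalfPlane → V) where
  carrier := {f | ∃ s N Q, A.IsQuasiModular k s N f Q}
  zero_mem' := ⟨0, 0, 0, .zero 0, fun _ _ => .zero 0, fun γ τ => by simp [slash_zero]⟩
  add_mem' := by
    rintro f g ⟨s, N, Q, hf⟩ ⟨s', N', Q', hg⟩
    have hf' := hf.mono (le_max_left s s') (le_max_left N N')
    have hg' := hg.mono (le_max_right s s') (le_max_right N N')
    refine ⟨_, _, _, hf'.form.add hg'.form, fun n hn => (hf'.coeff n hn).add (hg'.coeff n hn),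
      fun γ τ => ?_⟩
    rw [slash_add, hf'.slash_eq, hg'.slash_eq, ← Finset.sum_add_distrib]
    simp
  smul_mem' := by
    rintro c f ⟨s, N, Q, hf⟩
    refine ⟨s, N, fun n => c • Q n, hf.form.smul c, fun n hn => (hf.coeff n hn).smul c,
      fun γ τ => ?_⟩
    rw [slash_smul, hf.slash_eq, Finset.smul_sum]
    simp [smul_comm c]

end QVOA

/-- The formal variable `q`, as a Laurent series. -/
def qVar : LaurentSeries ℚ := HahnSeries.single 1 1

end

noncomputable section

open VertexOperator (ncoeff)
open UpperHalfPlane (ofComplex IsBoundedAtImInfty)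
open scoped Manifold MatrixGroups ModularForm

attribute [local instance] LieRing.ofAssociativeRing

local notation "SL2Z" => Matrix.SpecialLinearGroup (Fin 2) ℤ

/-! The vector-valued slash action can be untwisted into scalar ones. Let e = -(π i / 6) E₂. Its
constant is chosen so that e(γτ) = j² e(τ) - c j, with j = j(γ, τ). The operator K⁻¹ = j^(2 L(0))
exp(c j L(1)) contains exactly this defect c j, and j^(2 L(0)) exp(j² t L(1)) = exp(t L(1)) j^(2
L(0)). Hence F = exp(-e L(1)) f satisfies exp(-e L(1)) (f ‖_k γ) = j^(-k) j^(2 L(0)) F(γτ): each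
coordinate of F along a homogeneous basis vector of degree n transforms by the scalar slash operator
of weight k - 2n (`untwistCoord_slash`). Since L(1) lowers degrees and e is holomorphic also at the
cusp, the twist preserves F_N V and holomorphy. So f is modular, or quasi-modular of depth at most
s, exactly when f takes values in some F_N V and all these coordinates have the same property as
scalar functions (`exists_isQuasiModular_iff`).

CFT-type forces V_n = 0 for n < 0, by 𝔰𝔩₂ theory (`deg_eq_bot_of_neg`), and there are no nonzero
scalar forms of negative weight. In weight 2k only the degrees 0 ≤ n ≤ k contribute, and each basis
vector of degree n contributes one copy of the scalar forms of weight 2k - 2n. The generating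
function is therefore dim_q V times the scalar one.

For scalars, the top coefficient of a quasi-modular form is modular (`top_slash`), and subtracting a
multiple of a power of e lowers the depth (`scalarQuasiSucc_bijective`). Thus the forms of weight 2j
are the direct sum of the e^i M_{2j-2i}, and their dimensions are partial sums of dim M_{2i}. The
dimension formula of level one gives 1 / ((1 - q²)(1 - q³)) for modular forms, and partial sums
supply the further factor 1 / (1 - q). -/

/-! ### Scalar functions that are holomorphic, also at the cusp -/

/-- The algebra of holomorphic functions on the upper half-plane that have period `1` and are
bounded at the cusp. -/
def cuspHolomorphic : Subalgebra ℂ (UpperHalfPlane → ℂ) where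
  carrier := {f | MDiff f ∧ Function.Periodic (f ∘ ofComplex) 1 ∧ IsBoundedAtImInfty f}
  mul_mem' := by
    rintro f g ⟨hf, hf', hf''⟩ ⟨hg, hg', hg''⟩
    exact ⟨hf.mul hg, hf'.mul hg', hf''.mul hg''⟩
  add_mem' := by
    rintro f g ⟨hf, hf', hf''⟩ ⟨hg, hg', hg''⟩
    exact ⟨hf.add hg, hf'.add hg', hf''.add hg''⟩
  algebraMap_mem' c := by
    refine ⟨mdifferentiable_const, fun z => rfl, ?_⟩
    exact Filter.const_boundedAtFilter _ c

theorem mem_cuspHolomorphic_iff {f : UpperHalfPlane → ℂ} :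
    f ∈ cuspHolomorphic ↔ MDiff f ∧ ∃ c : ℕ → ℂ, ∀ τ : UpperHalfPlane,
      HasSum (fun n => c n * Function.Periodic.qParam 1 (τ : ℂ) ^ n) (f τ) := by
  constructor
  · rintro ⟨hf, hp, hb⟩
    exact ⟨hf, _, fun τ => UpperHalfPlane.hasSum_qExpansion one_pos (by simpa using hp) hf hb τ⟩
  · rintro ⟨hf, c, hc⟩
    refine ⟨hf, fun z => ?_, UpperHalfPlane.isBoundedAtImInfty_of_hasSum_qExpansion one_pos
      (c := c) (by simpa using hc)⟩
    simp only [Function.comp_apply]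
    by_cases hz : 0 < z.im
    · have hz' : 0 < (z + 1).im := by simpa using hz
      have h1 := hc (ofComplex (z + 1))
      have h2 := hc (ofComplex z)
      rw [UpperHalfPlane.ofComplex_apply_of_im_pos hz'] at h1 ⊢
      rw [UpperHalfPlane.ofComplex_apply_of_im_pos hz] at h2 ⊢
      have h3 : Function.Periodic.qParam 1 (z + 1) = Function.Periodic.qParam 1 z := by
        simp [Function.Periodic.qParam, mul_add, Complex.exp_add]
      simp only [h3] at h1
      exact h1.unique h2
    -- Off the upper half-plane `ofComplex` has one fixed default value, so periodicity is automatic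
    -- there.
    · have hz' : (z + 1).im ≤ 0 := by simpa using hz
      rw [UpperHalfPlane.ofComplex_apply_of_im_nonpos hz',
        UpperHalfPlane.ofComplex_apply_of_im_nonpos (not_lt.mp hz)]

/-! ### The cocycles j and X, and the Eisenstein series of weight 2 -/

theorem autFactor_eq_denom (γ : SL2Z) (τ : UpperHalfPlane) :
    autFactor γ τ = UpperHalfPlane.denom γ τ := by
  simp [autFactor, ModularGroup.denom_apply]

theorem autFactor_mul (γ γ' : SL2Z) (τ : UpperHalfPlane) :
    autFactor (γ * γ') τ = autFactor γ (γ' • τ) * autFactor γ' τ := by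
  have hj := autFactor_ne_zero γ' τ
  have h : ((γ' • τ : UpperHalfPlane) : ℂ) * autFactor γ' τ = γ' 0 0 * τ + γ' 0 1 := by
    have h1 := UpperHalfPlane.coe_specialLinearGroup_apply γ' τ
    simp only [algebraMap_int_eq, eq_intCast, Complex.ofReal_intCast] at h1
    rw [h1]
    exact div_mul_cancel₀ _ hj
  simp only [autFactor] at h ⊢
  simp only [Matrix.SpecialLinearGroup.coe_mul, Matrix.mul_apply, Fin.sum_univ_two]
  push_cast
  linear_combination -(γ 1 0 : ℂ) * h

theorem autX_mul (γ γ' : SL2Z) (τ : UpperHalfPlane) :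
    autX (γ * γ') τ = autX γ (γ' • τ) * (autFactor γ' τ ^ 2)⁻¹ + autX γ' τ := by
  have h1 := autFactor_ne_zero γ (γ' • τ)
  have h2 := autFactor_ne_zero γ' τ
  -- With denominators cleared, the cocycle rule for X is the determinant condition on γ'.
  have h3 : ((γ * γ') 1 0 : ℂ) * autFactor γ' τ =
      γ 1 0 + γ' 1 0 * autFactor (γ * γ') τ := by
    have hd := congrArg (Int.cast : ℤ → ℂ) γ'.det_coe
    rw [Matrix.det_fin_two] at hd
    push_cast at hd
    simp only [autFactor, Matrix.SpecialLinearGroup.coe_mul, Matrix.mul_apply, Fin.sum_univ_two]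
    push_cast
    linear_combination (γ 1 0 : ℂ) * hd
  rw [autFactor_mul] at h3
  rw [autX, autX, autX, autFactor_mul]
  field_simp
  linear_combination h3

theorem autX_one (τ : UpperHalfPlane) : autX 1 τ = 0 := by
  simp [autX]

theorem autFactor_one (τ : UpperHalfPlane) : autFactor 1 τ = 1 := by
  simp [autFactor]

/-- The lower unipotent matrices with entry n already give distinct values n / (nτ + 1). This turns
identities in X(γ, τ), valid for all γ at fixed τ, into identities of polynomials. -/
theorem infinite_range_autX (τ : UpperHalfPlane) : (Set.range fun γ => autX γ τ).Infinite := by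
  let u : ℤ → SL2Z := fun n => ⟨!![1, 0; n, 1], by simp [Matrix.det_fin_two]⟩
  have hu : Function.Injective fun n => autX (u n) τ := by
    intro m n h
    have hm := autFactor_ne_zero (u m) τ
    have hn := autFactor_ne_zero (u n) τ
    simp only [autX] at h
    rw [div_eq_div_iff hm hn] at h
    simp only [autFactor, u, Matrix.of_apply, Matrix.cons_val] at h
    have : (m : ℂ) = n := by push_cast at h; linear_combination h
    exact_mod_cast this
  refine (Set.infinite_range_of_injective hu).mono ?_
  rintro _ ⟨n, rfl⟩
  exact ⟨u n, rfl⟩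

/-- The multiple `-(π i / 6) E₂` of the Eisenstein series of weight `2`. -/
def scaledE2 (τ : UpperHalfPlane) : ℂ := -(Real.pi * Complex.I / 6) * EisensteinSeries.E2 τ

theorem scaledE2_mem : scaledE2 ∈ cuspHolomorphic := by
  have h : EisensteinSeries.E2 ∈ cuspHolomorphic := by
    refine mem_cuspHolomorphic_iff.mpr ⟨E2_mdifferentiable,
      fun m => if m = 0 then 1 else -24 * ArithmeticFunction.sigma 1 m, fun τ => ?_⟩
    simpa [Function.Periodic.qParam] using EisensteinSeries.hasSum_qExpansion_E2 (z := τ)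
  exact cuspHolomorphic.smul_mem h (-(Real.pi * Complex.I / 6))

/-- The normalization of `scaledE2` makes the anomaly of E₂, which involves π and ζ(2) = π²/6, equal
to exactly -c j. -/
theorem scaledE2_smul (γ : SL2Z) (τ : UpperHalfPlane) :
    scaledE2 (γ • τ) =
      autFactor γ τ ^ 2 * scaledE2 τ - (γ 1 0 : ℂ) * autFactor γ τ := by
  have h := congrFun (EisensteinSeries.E2_slash_action γ) τ
  rw [ModularForm.SL_slash_apply, Pi.sub_apply, Pi.smul_apply, EisensteinSeries.D2,
    riemannZeta_two, ← autFactor_eq_denom, zpow_neg, smul_eq_mul] at h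
  have hj := autFactor_ne_zero γ τ
  have hpi : (Real.pi : ℂ) ≠ 0 := by exact_mod_cast Real.pi_ne_zero
  norm_cast at h
  push_cast at h
  rw [scaledE2, scaledE2]
  field_simp at h ⊢
  linear_combination -Complex.I * h + 6 * (γ 1 0 : ℂ) * autFactor γ τ * Complex.I_sq

/-! ### Scalar quasi-modular forms -/

/-- The scalar function `f` is quasi-modular of weight `k` and depth at most `s`, with coefficient
functions `Q 0, …, Q s`. -/
structure IsScalarQuasiModular (k : ℤ) (s : ℕ) (f : UpperHalfPlane → ℂ)
    (Q : ℕ → UpperHalfPlane → ℂ) : Prop where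
  coeff : ∀ n, Q n ∈ cuspHolomorphic
  slash_eq : ∀ γ τ, autFactor γ τ ^ (-k) * f (γ • τ) =
    ∑ n ∈ Finset.range (s + 1), autX γ τ ^ n * Q n τ

namespace IsScalarQuasiModular

variable {k : ℤ} {s : ℕ} {f g : UpperHalfPlane → ℂ} {Q R : ℕ → UpperHalfPlane → ℂ}

theorem mono (h : IsScalarQuasiModular k s f Q) {t : ℕ} (hst : s ≤ t) :
    IsScalarQuasiModular k t f (fun n => if n ≤ s then Q n else 0) where
  coeff n := by
    split_ifs
    · exact h.coeff n
    · exact zero_mem _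
  slash_eq γ τ := by
    rw [h.slash_eq, ← Finset.sum_subset (Finset.range_mono (Nat.add_le_add_right hst 1))]
    · refine Finset.sum_congr rfl fun n hn => ?_
      rw [if_pos (Nat.lt_succ_iff.mp (Finset.mem_range.mp hn))]
    · intro n _ hn
      rw [if_neg (fun h' => hn (Finset.mem_range.mpr (Nat.lt_succ_of_le h')))]
      simp

theorem add (hf : IsScalarQuasiModular k s f Q) (hg : IsScalarQuasiModular k s g R) :
    IsScalarQuasiModular k s (f + g) (Q + R) where
  coeff n := add_mem (hf.coeff n) (hg.coeff n)
  slash_eq γ τ := by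
    simp only [Pi.add_apply, mul_add, hf.slash_eq, hg.slash_eq, Finset.sum_add_distrib]

theorem smul (c : ℂ) (hf : IsScalarQuasiModular k s f Q) :
    IsScalarQuasiModular k s (c • f) (c • Q) where
  coeff n := cuspHolomorphic.smul_mem (hf.coeff n) c
  slash_eq γ τ := by
    simp only [Pi.smul_apply, smul_eq_mul, mul_left_comm _ c, hf.slash_eq, ← Finset.mul_sum]

/-- At γ = 1 one has X = 0 and j = 1, so only the term n = 0 survives. -/
theorem eq_coeff_zero (h : IsScalarQuasiModular k s f Q) : f = Q 0 := by
  funext τ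
  have h1 := h.slash_eq 1 τ
  rw [Finset.sum_eq_single 0] at h1
  · simpa [autFactor_one] using h1
  · intro n _ hn
    simp [autX_one, hn]
  · simp

theorem mem (h : IsScalarQuasiModular k s f Q) : f ∈ cuspHolomorphic :=
  h.eq_coeff_zero ▸ h.coeff 0

/-- The top coefficient of a quasi-modular form is modular. -/
theorem top_slash (h : IsScalarQuasiModular k s f Q) (γ : SL2Z) (τ : UpperHalfPlane) :
    autFactor γ τ ^ (-(k - 2 * s)) * Q s (γ • τ) = Q s τ := by
  open Polynomial in
  let j := autFactor γ τ
  have hj : j ≠ 0 := autFactor_ne_zero γ τ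
  -- By the cocycle rule, X(γ'γ, τ) is p evaluated at X(γ', γτ). Expanding the slash of f by γ'γ in
  -- two ways gives `P₁` and `P₂`, which agree at the infinitely many values of X(γ', γτ).
  let p : ℂ[X] := C (j ^ 2)⁻¹ * X + C (autX γ τ)
  have hp : p.natDegree ≤ 1 := natDegree_linear_le
  let P₁ : ℂ[X] := ∑ n ∈ Finset.range (s + 1), C (j ^ (-k) * Q n (γ • τ)) * X ^ n
  let P₂ : ℂ[X] := ∑ n ∈ Finset.range (s + 1), C (Q n τ) * p ^ n
  have key : P₁ = P₂ := by
    refine eq_of_infinite_eval_eq _ _ ((infinite_range_autX (γ • τ)).mono ?_)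
    rintro _ ⟨γ', rfl⟩
    have h1 := h.slash_eq (γ' * γ) τ
    have h2 := h.slash_eq γ' (γ • τ)
    rw [autFactor_mul, mul_smul, mul_zpow, mul_right_comm, h2, autX_mul, Finset.sum_mul] at h1
    simp only [P₁, P₂, p, Set.mem_ofPred_eq, eval_finsetSum, eval_mul, eval_C, eval_pow, eval_X,
      eval_add]
    convert! h1 using 2
    · ring
    · ring
  -- Since p is linear, only the term n = s of `P₂` reaches degree s, with leading coefficient
  -- j^(-2s). This accounts for the weight k - 2s.
  have hc := congrArg (fun q => Polynomial.coeff q s) key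
  simp only [P₁, P₂, finsetSum_coeff, coeff_C_mul, coeff_X_pow] at hc
  rw [Finset.sum_eq_single s (by intro n _ hn; simp [hn.symm]) (by simp),
    Finset.sum_eq_single s] at hc
  · have h1 := coeff_pow_of_natDegree_le (m := s) hp
    rw [mul_one] at h1
    have h2 : p.coeff 1 = (j ^ 2)⁻¹ := by simp [p]
    rw [h1, h2, if_pos rfl, mul_one] at hc
    have h3 : j ^ (-(k - 2 * (s : ℤ))) = (j ^ 2) ^ s * j ^ (-k) := by
      rw [← pow_mul, ← zpow_natCast, ← zpow_add₀ hj]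
      congr 1
      push_cast
      ring
    change j ^ (-(k - 2 * (s : ℤ))) * _ = _
    rw [h3, mul_assoc, hc, mul_left_comm, ← mul_pow, mul_inv_cancel₀ (pow_ne_zero 2 hj), one_pow,
      mul_one]
  · intro n hn hns
    have h1 : (p ^ n).natDegree < s := by
      refine (natDegree_pow_le_of_le n hp).trans_lt ?_
      have := Finset.mem_range.mp hn
      omega
    rw [coeff_eq_zero_of_natDegree_lt h1, mul_zero]
  · simp

/-- The coefficients of the zero form vanish. -/
theorem coeff_eq_zero (h : IsScalarQuasiModular k s 0 Q) {n : ℕ} (hn : n ≤ s) : Q n = 0 := by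
  open Polynomial in
  funext τ
  let P : ℂ[X] := ∑ n ∈ Finset.range (s + 1), C (Q n τ) * X ^ n
  have key : P = 0 := by
    refine eq_of_infinite_eval_eq _ _ ((infinite_range_autX τ).mono ?_)
    rintro _ ⟨γ', rfl⟩
    have h1 := h.slash_eq γ' τ
    simp only [P, Set.mem_ofPred_eq, eval_finsetSum, eval_mul, eval_C, eval_pow, eval_X, eval_zero]
    simp only [Pi.zero_apply, mul_zero] at h1
    rw [h1]
    exact Finset.sum_congr rfl fun _ _ => mul_comm _ _
  have hc := congrArg (fun q => Polynomial.coeff q n) key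
  simpa [P, finsetSum_coeff, coeff_C_mul, coeff_X_pow, Nat.lt_succ_of_le hn] using hc

end IsScalarQuasiModular

/-- The space of scalar quasi-modular forms of weight `k` and depth at most `s`. -/
def scalarQuasi (k : ℤ) (s : ℕ) : Submodule ℂ (UpperHalfPlane → ℂ) where
  carrier := {f | ∃ Q, IsScalarQuasiModular k s f Q}
  zero_mem' := ⟨0, fun _ => zero_mem _, fun γ τ => by simp⟩
  add_mem' := by
    rintro f g ⟨Q, hf⟩ ⟨R, hg⟩
    exact ⟨_, hf.add hg⟩
  smul_mem' := by
    rintro c f ⟨Q, hf⟩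
    exact ⟨_, hf.smul c⟩

theorem scalarQuasi_mono (k : ℤ) {s t : ℕ} (h : s ≤ t) : scalarQuasi k s ≤ scalarQuasi k t :=
  fun _ ⟨_, hf⟩ => ⟨_, hf.mono h⟩

theorem mem_scalarQuasi_zero_iff {k : ℤ} {f : UpperHalfPlane → ℂ} :
    f ∈ scalarQuasi k 0 ↔ f ∈ cuspHolomorphic ∧
      ∀ (γ : SL2Z) τ, autFactor γ τ ^ (-k) * f (γ • τ) = f τ := by
  constructor
  · rintro ⟨Q, hf⟩
    refine ⟨hf.mem, fun γ τ => ?_⟩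
    rw [hf.slash_eq, hf.eq_coeff_zero]
    simp
  · rintro ⟨hf, h⟩
    exact ⟨fun _ => f, fun _ => hf, fun γ τ => by simpa [-ModularGroup.sl_moeb] using h γ τ⟩

/-- The coefficient functions of `e ^ s h`, where `e` is the scaled Eisenstein series of weight `2`
and `h` is modular of weight `k - 2 s`. -/
def scaledE2PowCoeff (s : ℕ) (h : UpperHalfPlane → ℂ) (n : ℕ) : UpperHalfPlane → ℂ :=
  ((-1) ^ n * (s.choose n : ℂ)) • (scaledE2 ^ (s - n) * h)

/-- Slashing replaces e by e - X and leaves h fixed; the coefficients are those of the binomial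
expansion of (e - X)^s h. -/
theorem isScalarQuasiModular_scaledE2_pow_mul {k : ℤ} {s : ℕ} {h : UpperHalfPlane → ℂ}
    (hh : h ∈ scalarQuasi (k - 2 * s) 0) :
    IsScalarQuasiModular k s (scaledE2 ^ s * h) (scaledE2PowCoeff s h) where
  coeff n := cuspHolomorphic.smul_mem
    (mul_mem (pow_mem scaledE2_mem _) (mem_scalarQuasi_zero_iff.mp hh).1) _
  slash_eq γ τ := by
    have hj := autFactor_ne_zero γ τ
    have h1 : scaledE2 (γ • τ) = autFactor γ τ ^ 2 * (-autX γ τ + scaledE2 τ) := by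
      rw [scaledE2_smul, autX]
      field_simp
      ring
    have h2 : autFactor γ τ ^ (-(k - 2 * s)) = autFactor γ τ ^ (-k) * (autFactor γ τ ^ 2) ^ s := by
      rw [← pow_mul, ← zpow_natCast, ← zpow_add₀ hj]
      congr 1
      push_cast
      ring
    have h3 := (mem_scalarQuasi_zero_iff.mp hh).2 γ τ
    rw [h2] at h3
    have h4 : autFactor γ τ ^ (-k) * (scaledE2 ^ s * h) (γ • τ) =
        (-autX γ τ + scaledE2 τ) ^ s * h τ := by
      rw [← h3, Pi.mul_apply, Pi.pow_apply, h1, mul_pow]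
      ring
    rw [h4, add_pow, Finset.sum_mul]
    refine Finset.sum_congr rfl fun n _ => ?_
    simp only [scaledE2PowCoeff, Pi.smul_apply, Pi.mul_apply, Pi.pow_apply, smul_eq_mul]
    rw [neg_pow]
    ring

theorem scaledE2PowCoeff_self (s : ℕ) (h : UpperHalfPlane → ℂ) :
    scaledE2PowCoeff s h s = (-1 : ℂ) ^ s • h := by
  simp [scaledE2PowCoeff]

theorem IsScalarQuasiModular.sub_top_mem {k : ℤ} {s : ℕ} {f : UpperHalfPlane → ℂ}
    {Q : ℕ → UpperHalfPlane → ℂ} (h : IsScalarQuasiModular k (s + 1) f Q)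
    (h0 : Q (s + 1) = 0) : f ∈ scalarQuasi k s :=
  ⟨Q, h.coeff, fun γ τ => by rw [h.slash_eq, Finset.sum_range_succ, h0]; simp⟩

theorem IsScalarQuasiModular.top_mem {k : ℤ} {s : ℕ} {f : UpperHalfPlane → ℂ}
    {Q : ℕ → UpperHalfPlane → ℂ} (h : IsScalarQuasiModular k s f Q) :
    Q s ∈ scalarQuasi (k - 2 * s) 0 :=
  mem_scalarQuasi_zero_iff.mpr ⟨h.coeff s, h.top_slash⟩

/-- The decomposition of the forms of depth at most `s + 1`: up to a form of depth at most `s`,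
they are multiples of the power `e ^ (s + 1)` of the scaled Eisenstein series of weight `2`. -/
def scalarQuasiSucc (k : ℤ) (s : ℕ) :
    (scalarQuasi k s × scalarQuasi (k - 2 * (s + 1 : ℕ)) 0) →ₗ[ℂ] scalarQuasi k (s + 1) where
  toFun p := ⟨p.1 + scaledE2 ^ (s + 1) * p.2, add_mem (scalarQuasi_mono k s.le_succ p.1.2)
    ⟨_, isScalarQuasiModular_scaledE2_pow_mul p.2.2⟩⟩
  map_add' p q := by
    ext1
    simp only [Prod.fst_add, Prod.snd_add, Submodule.coe_add]
    ring
  map_smul' c p := by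
    ext1
    simp [smul_add]

/-- The form e^(s+1) h has top coefficient (-1)^(s+1) h. If it cancels a form of depth at most s,
then h = 0 by uniqueness of the coefficients. Conversely, h = (-1)^(s+1) Q_{s+1} is modular, and
removing e^(s+1) h kills the top coefficient. -/
theorem scalarQuasiSucc_bijective (k : ℤ) (s : ℕ) : Function.Bijective (scalarQuasiSucc k s) := by
  constructor
  · rw [← LinearMap.ker_eq_bot, LinearMap.ker_eq_bot']
    rintro ⟨⟨f, Q, hf⟩, ⟨h, hh⟩⟩ hfh
    have h1 : f + scaledE2 ^ (s + 1) * h = 0 := congrArg Subtype.val hfh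
    have h2 := (hf.mono s.le_succ).add (isScalarQuasiModular_scaledE2_pow_mul hh)
    rw [h1] at h2
    have h3 := h2.coeff_eq_zero le_rfl
    have h4 : h = 0 := by simpa [scaledE2PowCoeff_self] using h3
    subst h4
    rw [mul_zero, add_zero] at h1
    subst h1
    rfl
  · rintro ⟨f, Q, hf⟩
    let h := (-1 : ℂ) ^ (s + 1) • Q (s + 1)
    have hh : h ∈ scalarQuasi (k - 2 * (s + 1 : ℕ)) 0 := Submodule.smul_mem _ _ hf.top_mem
    have h1 := hf.add ((isScalarQuasiModular_scaledE2_pow_mul hh).smul (-1))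
    refine ⟨(⟨_, h1.sub_top_mem ?_⟩, ⟨h, hh⟩), ?_⟩
    · rw [Pi.add_apply, Pi.smul_apply, scaledE2PowCoeff_self, smul_smul, smul_smul]
      simp [← mul_pow]
    · ext1
      simp [scalarQuasiSucc]

/-- Scalar modular forms, as functions, form the same space as Mathlib's modular forms of level
one. -/
def scalarQuasiZeroEquiv (k : ℤ) : scalarQuasi k 0 ≃ₗ[ℂ] ModularForm 𝒮ℒ k where
  toFun f :=
    have hf := mem_scalarQuasi_zero_iff.mp f.2
    have hs : ∀ γ : SL2Z, f.1 ∣[k] γ = f.1 := fun γ => by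
      funext τ
      rw [ModularForm.SL_slash_apply, ← autFactor_eq_denom, mul_comm]
      exact hf.2 γ τ
    { toFun := f
      slash_action_eq' := fun _ ⟨γ, hγ⟩ => hγ ▸ hs γ
      holo' := hf.1.1
      bdd_at_cusps' {c} hc := by
        rw [Subgroup.IsArithmetic.isCusp_iff_isCusp_SL2Z] at hc
        rw [OnePoint.isBoundedAt_iff_forall_SL2Z hc]
        intro γ _
        rw [hs γ]
        exact hf.1.2.2 }
  map_add' _ _ := rfl
  map_smul' _ _ := rfl
  invFun f := ⟨f, mem_scalarQuasi_zero_iff.mpr ⟨mem_cuspHolomorphic_iff.mpr ⟨f.holo', _,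
    fun τ => ModularForm.hasSum_qExpansion f one_pos one_mem_strictPeriods_SL τ⟩,
    fun γ τ => by
      have h := congrFun (SlashInvariantFormClass.slash_action_eq f _ (MonoidHom.mem_range.mpr ⟨γ, rfl⟩)) τ
      rw [autFactor_eq_denom, mul_comm, ← h]
      exact (ModularForm.SL_slash_apply _ _ _).symm⟩⟩
  left_inv _ := rfl
  right_inv _ := rfl

/-! ### Dimensions of the spaces of scalar forms -/

instance (k : ℤ) (s : ℕ) : FiniteDimensional ℂ (scalarQuasi k s) := by
  induction s with
  | zero => exact (scalarQuasiZeroEquiv k).symm.finiteDimensional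
  | succ s ih =>
    have := (scalarQuasiZeroEquiv (k - 2 * (s + 1 : ℕ))).symm.finiteDimensional
    exact (LinearEquiv.ofBijective _ (scalarQuasiSucc_bijective k s)).finiteDimensional

theorem finrank_scalarQuasi_succ (k : ℤ) (s : ℕ) :
    Module.finrank ℂ (scalarQuasi k (s + 1)) =
      Module.finrank ℂ (scalarQuasi k s) +
        Module.finrank ℂ (scalarQuasi (k - 2 * (s + 1 : ℕ)) 0) := by
  rw [← (LinearEquiv.ofBijective _ (scalarQuasiSucc_bijective k s)).finrank_eq,
    Module.finrank_prod]

theorem finrank_scalarQuasi_zero_of_neg {k : ℤ} (hk : k < 0) :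
    Module.finrank ℂ (scalarQuasi k 0) = 0 := by
  rw [(scalarQuasiZeroEquiv k).finrank_eq, Module.finrank,
    ModularForm.levelOne_neg_weight_rank_zero hk, map_zero]

theorem finrank_scalarQuasi_eq_sum (k s : ℕ) :
    Module.finrank ℂ (scalarQuasi (2 * k) s) =
      ∑ i ∈ Finset.range (s + 1), Module.finrank ℂ (scalarQuasi (2 * k - 2 * i) 0) := by
  induction s with
  | zero => rw [Finset.sum_range_one, Nat.cast_zero, mul_zero, sub_zero]
  | succ s ih => rw [finrank_scalarQuasi_succ, ih, Finset.sum_range_succ _ (s + 1)]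

theorem scalarQuasi_eq_bot_of_neg {k : ℤ} (hk : k < 0) (s : ℕ) : scalarQuasi k s = ⊥ := by
  rw [← Submodule.finrank_eq_zero (R := ℂ)]
  induction s with
  | zero => exact finrank_scalarQuasi_zero_of_neg hk
  | succ s ih =>
    rw [finrank_scalarQuasi_succ, ih, finrank_scalarQuasi_zero_of_neg (by omega)]

/-- The depth of a quasi-modular form is at most half of its weight. -/
theorem scalarQuasi_le_of_weight_le {k : ℤ} {t : ℕ} (h : k ≤ 2 * t) (s : ℕ) :
    scalarQuasi k s ≤ scalarQuasi k t := by
  rcases le_total s t with hst | hst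
  · exact scalarQuasi_mono k hst
  · induction s, hst using Nat.le_induction with
    | base => exact le_rfl
    | succ s hs ih =>
      -- Passing from depth s to s + 1 adds a copy of the modular forms of weight k - 2(s + 1),
      -- which is negative because s ≥ t.
      refine le_trans (Submodule.eq_of_le_of_finrank_eq (scalarQuasi_mono k s.le_succ) ?_).ge ih
      rw [finrank_scalarQuasi_succ, finrank_scalarQuasi_zero_of_neg (by push_cast; omega), add_zero]

theorem finrank_scalarQuasi_zero (i : ℕ) :
    Module.finrank ℂ (scalarQuasi (2 * i) 0) =
      if i % 6 = 1 then i / 6 else i / 6 + 1 := by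
  have h := ModularForm.dimension_level_one (2 * i) (even_two_mul i)
  rw [(scalarQuasiZeroEquiv _).finrank_eq, Module.finrank]
  push_cast at h
  rw [h]
  have h1 : 2 * i ≡ 2 [MOD 12] ↔ i % 6 = 1 := by unfold Nat.ModEq; omega
  have h2 : 2 * i / 12 = i / 6 := by omega
  simp only [h1, h2]
  split_ifs <;> simp

/-! ### Homogeneous bases and truncations -/

namespace GradedVertexAlgebra

variable {V : Type*} [AddCommGroup V] [Module ℂ V] (A : GradedVertexAlgebra V)

/-- The index type of a homogeneous basis of `V`. -/
abbrev BasisIndex : Type := Σ k : ℤ, Fin (Module.finrank ℂ (A.deg k))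

/-- A basis of `V` that consists of homogeneous states. -/
def homBasis : Module.Basis A.BasisIndex ℂ V :=
  haveI := A.finiteDimensional
  A.internal.collectedBasis fun k => Module.finBasis ℂ (A.deg k)

theorem homBasis_mem (i : A.BasisIndex) : A.homBasis i ∈ A.deg i.1 :=
  haveI := A.finiteDimensional
  A.internal.collectedBasis_mem (fun k => Module.finBasis ℂ (A.deg k)) i

theorem deg_basisIndex_ne_bot (i : A.BasisIndex) : A.deg i.1 ≠ ⊥ := fun h =>
  A.homBasis.ne_zero i ((Submodule.mem_bot ℂ).mp (h ▸ A.homBasis_mem i))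

theorem homBasis_repr_of_mem_ne {k : ℤ} {a : V} (ha : a ∈ A.deg k) {i : A.BasisIndex}
    (hi : k ≠ i.1) : A.homBasis.repr a i = 0 :=
  haveI := A.finiteDimensional
  A.internal.collectedBasis_repr_of_mem_ne (fun k => Module.finBasis ℂ (A.deg k)) hi ha

theorem homBasis_repr_diag (c : ℤ → ℂ) (a : V) (i : A.BasisIndex) :
    A.homBasis.repr (A.diag c a) i = c i.1 * A.homBasis.repr a i := by
  refine Submodule.iSup_induction A.deg
    (motive := fun a => A.homBasis.repr (A.diag c a) i = c i.1 * A.homBasis.repr a i)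
    (A.span_deg a) ?_ (by simp) ?_
  · intro k a ha
    rw [A.diag_apply c ha, map_smul, Finsupp.smul_apply, smul_eq_mul]
    by_cases hk : k = i.1
    · rw [hk]
    · rw [A.homBasis_repr_of_mem_ne ha hk, mul_zero, mul_zero]
  · intro x y hx hy
    simp only [map_add, Finsupp.add_apply, hx, hy, mul_add]

theorem deg_le_trunc {k N : ℤ} (h : k ≤ N) : A.deg k ≤ A.trunc N :=
  le_iSup (fun n : {n : ℤ // n ≤ N} => A.deg n) ⟨k, h⟩

theorem finite_basisIndex_le (N : ℤ) : {i : A.BasisIndex | i.1 ≤ N}.Finite := by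
  obtain ⟨M, hM⟩ := A.bounded_below
  have h : {i : A.BasisIndex | i.1 ≤ N} ⊆ ⋃ k ∈ Set.Icc M N, Set.range (Sigma.mk k) := by
    rintro ⟨k, i⟩ hk
    have hMk : M ≤ k := by
      by_contra h
      exact A.deg_basisIndex_ne_bot ⟨k, i⟩ (hM k (not_le.mp h))
    exact Set.mem_biUnion (x := k) ⟨hMk, hk⟩ ⟨i, rfl⟩
  exact ((Set.finite_Icc M N).biUnion fun k _ => Set.finite_range _).subset h

theorem mem_trunc_iff {N : ℤ} {a : V} :
    a ∈ A.trunc N ↔ ∀ i : A.BasisIndex, N < i.1 → A.homBasis.repr a i = 0 := by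
  constructor
  · intro ha i hi
    refine Submodule.iSup_induction (fun n : {n : ℤ // n ≤ N} => A.deg n)
      (motive := fun a => A.homBasis.repr a i = 0) ha ?_ (by simp) ?_
    · intro k a ha
      exact A.homBasis_repr_of_mem_ne ha (by have := k.2; omega)
    · intro x y hx hy
      rw [map_add, Finsupp.add_apply, hx, hy, add_zero]
  · intro h
    rw [← A.homBasis.linearCombination_repr a, Finsupp.linearCombination_apply]
    refine Submodule.sum_mem _ fun i hi => Submodule.smul_mem _ _ (A.deg_le_trunc ?_ (A.homBasis_mem i))
    by_contra h'
    exact Finsupp.mem_support_iff.mp hi (h i (not_le.mp h'))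

theorem sum_homBasis_repr_of_mem_trunc {N : ℤ} {a : V} (ha : a ∈ A.trunc N) :
    ∑ i ∈ (A.finite_basisIndex_le N).toFinset, A.homBasis.repr a i • A.homBasis i = a := by
  refine A.homBasis.ext_elem fun j => ?_
  simp only [map_sum, map_smul, Finsupp.coe_finsetSum, Finset.sum_apply, Finsupp.smul_apply,
    Module.Basis.repr_self, smul_eq_mul]
  by_cases hj : j.1 ≤ N
  · rw [Finset.sum_eq_single j]
    · simp
    · intro i _ hij
      simp [hij]
    · intro h
      exact absurd (by simpa using hj) h
  · rw [A.mem_trunc_iff.mp ha j (not_le.mp hj)]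
    refine Finset.sum_eq_zero fun i hi => ?_
    have : i ≠ j := by
      rintro rfl
      exact hj (by simpa using hi)
    simp [this]

end GradedVertexAlgebra

/-! ### Vanishing of the negative degrees -/

namespace QVOA

variable {V : Type*} [AddCommGroup V] [Module ℂ V] (A : QVOA V)

theorem D_mem {k : ℤ} {a : V} (h0 : A.vac ∈ A.deg 0) (ha : a ∈ A.deg k) :
    A.toVertexAlgebra.D a ∈ A.deg (k + 1) := by
  have h := A.mode_mem k 0 (-2) a A.vac ha h0
  rwa [show k + 0 - -2 - 1 = k + 1 by ring] at h

theorem D_vac : A.toVertexAlgebra.D A.vac = 0 := by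
  set v := A.vac
  have hc : ∀ n : ℤ, 0 ≤ n → ncoeff (A.Y v) n v = 0 := A.creative v
  have hv : ncoeff (A.Y v) (-1) v = v := A.creates v
  have hD : ncoeff (A.Y v) (-2) v = A.toVertexAlgebra.D v := rfl
  have hD' : ncoeff (A.Y (A.toVertexAlgebra.D v)) (-1) v = A.toVertexAlgebra.D v := A.creates _
  -- For these indices the left side has the two terms D𝟏 and -D𝟏, which cancel, and the right side
  -- reduces to -D𝟏.
  have h := A.jacobi v v v (-1) 0 (-2)
  rw [finsum_eq_sum_of_support_subset (s := Finset.range 2),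
    finsum_eq_single _ 0] at h
  · simp [Finset.sum_range_succ, hD, hD', hv, hc 0 le_rfl] at h
    exact h
  · intro i hi
    have hi' : (1 : ℤ) ≤ i := by exact_mod_cast Nat.one_le_iff_ne_zero.mpr hi
    rw [hc (0 + i) (by omega), hc (-1 + i) (by omega)]
    simp
  · intro i hi
    by_contra h'
    have hi' : (2 : ℤ) ≤ i := by
      have : 1 < i := by simpa using h'
      exact_mod_cast this
    refine hi ?_
    beta_reduce
    rw [hc (-2 + i) (by omega)]
    simp

theorem L1_D (a : V) : A.L1 (A.toVertexAlgebra.D a) = A.toVertexAlgebra.D (A.L1 a) +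
    (2 : ℂ) • A.euler a := by
  have hb : ⁅sl2Lower, sl2Raise⁆ = (2 : ℂ) • sl2Zero := by
    apply Subtype.ext
    rw [LieAlgebra.SpecialLinear.sl_bracket]
    ext i j
    fin_cases i <;> fin_cases j <;> norm_num [sl2Zero, sl2Lower, sl2Raise]
  have h := A.rho.map_lie sl2Lower sl2Raise
  rw [hb, map_smul, A.rho_zero, A.rho_raise] at h
  have h2 := LinearMap.congr_fun h a
  simp only [LinearMap.smul_apply, Ring.lie_def, LinearMap.sub_apply, Module.End.mul_apply] at h2
  rw [h2]
  exact (add_sub_cancel _ _).symm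

/-- A quasi-vertex operator algebra of CFT-type is graded by the natural numbers. -/
theorem deg_eq_bot_of_neg (hA : A.IsCFTType) {k : ℤ} (hk : k < 0) : A.deg k = ⊥ := by
  by_contra hne
  obtain ⟨N, hN⟩ := A.bounded_below
  -- A nonzero v in the least occurring degree m < 0 is killed by L(1), so it generates a
  -- lowest-weight module under 𝔰𝔩₂.
  obtain ⟨m, hm, hmin⟩ := Int.exists_least_of_bdd (P := fun k => A.deg k ≠ ⊥)
    ⟨N, fun k hk => not_lt.mp fun h => hk (hN k h)⟩ ⟨k, hne⟩
  have hm0 : m < 0 := (hmin k hne).trans_lt hk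
  obtain ⟨v, hv, hv0⟩ := (A.deg m).ne_bot_iff.mp hm
  have hvac : A.vac ∈ A.deg 0 := by
    rw [hA]
    exact Submodule.mem_span_singleton_self _
  set D := A.toVertexAlgebra.D
  have hmem : ∀ j : ℕ, (D ^ j) v ∈ A.deg (m + j) := by
    intro j
    induction j with
    | zero => simpa using hv
    | succ j ih =>
      rw [pow_succ', Module.End.mul_apply]
      have := A.D_mem hvac ih
      rwa [add_assoc, ← Nat.cast_succ] at this
  have hL0 : A.L1 v = 0 := by
    have h := A.L1_mem hv
    have h0 : A.deg (m - 1) = ⊥ := by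
      by_contra h'
      have := hmin _ h'
      omega
    simpa [h0] using h
  have hL : ∀ j : ℕ, A.L1 ((D ^ (j + 1)) v) = ((j + 1) * (2 * m + j) : ℂ) • (D ^ j) v := by
    intro j
    induction j with
    | zero =>
      have h1 := A.L1_D v
      rw [hL0, map_zero, zero_add, GradedVertexAlgebra.euler, A.diag_apply _ hv, smul_smul] at h1
      simpa using h1
    | succ j ih =>
      rw [pow_succ' D (j + 1), Module.End.mul_apply, A.L1_D, ih, map_smul, ← Module.End.mul_apply,
        ← pow_succ', GradedVertexAlgebra.euler, A.diag_apply _ (hmem (j + 1)), smul_smul, ← add_smul]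
      congr 1
      push_cast
      ring
  -- The factor 2m + j vanishes only at j = -2m, which exceeds -m. Hence no power of D up to the
  -- exponent -m + 1 kills v.
  have hne : ∀ j : ℕ, (j : ℤ) ≤ -m + 1 → (D ^ j) v ≠ 0 := by
    intro j
    induction j with
    | zero => exact fun _ => by simpa using hv0
    | succ j ih =>
      intro hj h
      have h1 := hL j
      rw [h, map_zero] at h1
      rcases smul_eq_zero.mp h1.symm with h2 | h2
      · have h3 : ((j + 1) * (2 * m + j) : ℤ) = 0 := by exact_mod_cast h2
        rcases mul_eq_zero.mp h3 with h4 | h4 <;> push_cast at hj <;> omega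
      · exact ih (by push_cast at hj; omega) h2
  -- The vector D^(-m) v lies in V_0 = ℂ𝟏, which D kills; this contradicts D^(-m+1) v ≠ 0.
  obtain ⟨n, hn⟩ := Int.eq_ofNat_of_zero_le (show 0 ≤ -m by omega)
  have h1 := hmem n
  rw [show m + (n : ℤ) = 0 by omega, hA] at h1
  obtain ⟨c, hc⟩ := Submodule.mem_span_singleton.mp h1
  refine hne (n + 1) (by push_cast; omega) ?_
  rw [pow_succ', Module.End.mul_apply, ← hc, map_smul]
  exact (congrArg _ A.D_vac).trans (smul_zero c)

theorem basisIndex_nonneg (hA : A.IsCFTType) (i : A.BasisIndex) : 0 ≤ i.1 := by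
  by_contra h
  exact A.deg_basisIndex_ne_bot i (A.deg_eq_bot_of_neg hA (not_le.mp h))

end QVOA

/-! ### Untwisting by the exponential of L(1) -/

namespace QVOA

variable {V : Type*} [AddCommGroup V] [Module ℂ V] (A : QVOA V)

theorem L1_pow_mem {k : ℤ} {a : V} (ha : a ∈ A.deg k) (n : ℕ) : (A.L1 ^ n) a ∈ A.deg (k - n) := by
  induction n with
  | zero => simpa using ha
  | succ n ih =>
    rw [pow_succ', Module.End.mul_apply]
    have := A.L1_mem ih
    rwa [show k - ((n + 1 : ℕ) : ℤ) = k - n - 1 by push_cast; ring]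

theorem expL1_apply_eq_sum (t : ℂ) {a : V} {m : ℕ} (hm : ∀ n ≥ m, (A.L1 ^ n) a = 0) :
    A.expL1 t a = ∑ n ∈ Finset.range m, (t ^ n / (n.factorial : ℂ)) • (A.L1 ^ n) a := by
  refine finsum_eq_sum_of_support_subset _ fun n hn => ?_
  simp only [Finset.coe_range, Set.mem_Iio]
  by_contra h
  exact hn (by simp [hm n (not_lt.mp h)])

theorem expL1_mem_trunc (t : ℂ) {N : ℤ} {a : V} (ha : a ∈ A.trunc N) : A.expL1 t a ∈ A.trunc N := by
  refine Submodule.iSup_induction (fun n : {n : ℤ // n ≤ N} => A.deg n)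
    (motive := fun a => A.expL1 t a ∈ A.trunc N) ha ?_ (by simp) ?_
  · intro k a ha
    obtain ⟨m, hm⟩ := A.L1_locallyNilpotent a
    rw [A.expL1_apply_eq_sum t hm]
    exact Submodule.sum_mem _ fun n _ => Submodule.smul_mem _ _
      (A.deg_le_trunc (by have := k.2; omega) (A.L1_pow_mem ha n))
  · intro x y hx hy
    rw [map_add]
    exact add_mem hx hy

theorem expL1_neg_cancel (t : ℂ) (a : V) : A.expL1 (-t) (A.expL1 t a) = a := by
  rw [← Module.End.mul_apply, A.expL1_mul, neg_add_cancel, A.expL1_zero, Module.End.one_apply]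

theorem expL1_cancel_neg (t : ℂ) (a : V) : A.expL1 t (A.expL1 (-t) a) = a := by
  rw [← Module.End.mul_apply, A.expL1_mul, add_neg_cancel, A.expL1_zero, Module.End.one_apply]

/-- Commutation of `exp (t L(1))` with the action `j ^ (2 L(0))` of the torus. -/
theorem diag_expL1 {j : ℂ} (hj : j ≠ 0) (t : ℂ) (a : V) :
    A.diag (fun n => j ^ (2 * n)) (A.expL1 (j ^ 2 * t) a) =
      A.expL1 t (A.diag (fun n => j ^ (2 * n)) a) := by
  refine Submodule.iSup_induction A.deg
    (motive := fun a => A.diag (fun n => j ^ (2 * n)) (A.expL1 (j ^ 2 * t) a) =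
      A.expL1 t (A.diag (fun n => j ^ (2 * n)) a))
    (A.span_deg a) ?_ (by simp) ?_
  · intro k a ha
    obtain ⟨m, hm⟩ := A.L1_locallyNilpotent a
    rw [A.diag_apply _ ha, map_smul, A.expL1_apply_eq_sum _ hm, A.expL1_apply_eq_sum _ hm, map_sum,
      Finset.smul_sum]
    refine Finset.sum_congr rfl fun n _ => ?_
    rw [map_smul, A.diag_apply _ (A.L1_pow_mem ha n), smul_smul, smul_smul]
    congr 1
    -- L(1)^n lowers the degree by n, which costs a factor j^(2n); this cancels (j²)^n from the
    -- exponential.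
    rw [mul_sub, zpow_sub₀ hj, mul_pow, ← pow_mul]
    have h : j ^ (2 * (n : ℤ)) = j ^ (2 * n) := by exact_mod_cast zpow_natCast j (2 * n)
    rw [h]
    field_simp
  · intro x y hx hy
    simp only [map_add, hx, hy]

variable {A} in
-- Vectors of F_N V are combinations of the finitely many basis vectors of degree at most N, so any
-- functional, and the expansion at the cusp, can be assembled from coordinates.
theorem isHolomorphicForm_iff {N : ℤ} {f : UpperHalfPlane → V} :
    A.IsHolomorphicForm N f ↔ (∀ τ, f τ ∈ A.trunc N) ∧
      ∀ i, (fun τ => A.homBasis.repr (f τ) i) ∈ cuspHolomorphic := by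
  constructor
  · rintro ⟨h, hf, c, -, hc⟩
    exact ⟨h, fun i => mem_cuspHolomorphic_iff.mpr
      ⟨hf (A.homBasis.coord i), fun n => A.homBasis.coord i (c n), hc (A.homBasis.coord i)⟩⟩
  · rintro ⟨h, hf⟩
    have hφ : ∀ φ : Module.Dual ℂ V, (fun τ => φ (f τ)) ∈ cuspHolomorphic := by
      intro φ
      have h1 : (fun τ => φ (f τ)) = ∑ i ∈ (A.finite_basisIndex_le N).toFinset,
          φ (A.homBasis i) • fun τ => A.homBasis.repr (f τ) i := by
        funext τ
        conv_lhs => rw [← A.sum_homBasis_repr_of_mem_trunc (h τ)]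
        simp [mul_comm]
      rw [h1]
      exact Subalgebra.sum_mem _ fun i _ => cuspHolomorphic.smul_mem (hf i) _
    choose c hc using fun i => (mem_cuspHolomorphic_iff.mp (hf i)).2
    refine ⟨h, fun φ => (hφ φ).1,
      fun n => ∑ i ∈ (A.finite_basisIndex_le N).toFinset, c i n • A.homBasis i, fun n => ?_,
      fun φ τ => ?_⟩
    · exact Submodule.sum_mem _ fun i hi => Submodule.smul_mem _ _
        (A.deg_le_trunc (by simpa using hi) (A.homBasis_mem i))
    · rw [← A.sum_homBasis_repr_of_mem_trunc (h τ)]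
      simp only [map_sum, map_smul, smul_eq_mul, Finset.sum_mul]
      refine hasSum_sum fun i _ => ?_
      simpa only [mul_right_comm] using (hc i τ).mul_right (φ (A.homBasis i))

variable {A} in
/-- Twisting by `exp (h L(1))` preserves holomorphic forms. -/
theorem IsHolomorphicForm.expL1 {N : ℤ} {f : UpperHalfPlane → V} (hf : A.IsHolomorphicForm N f)
    {h : UpperHalfPlane → ℂ} (hh : h ∈ cuspHolomorphic) :
    A.IsHolomorphicForm N fun τ => A.expL1 (h τ) (f τ) := by
  have hf' := isHolomorphicForm_iff.mp hf
  refine isHolomorphicForm_iff.mpr ⟨fun τ => A.expL1_mem_trunc _ (hf.mem_trunc τ), fun i => ?_⟩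
  choose m hm using fun j => A.L1_locallyNilpotent (A.homBasis j)
  -- By local nilpotency on the finitely many basis vectors involved, each new coordinate is a
  -- finite sum of constants times old coordinates times powers of h.
  have h1 : (fun τ => A.homBasis.repr (A.expL1 (h τ) (f τ)) i) =
      ∑ j ∈ (A.finite_basisIndex_le N).toFinset, ∑ n ∈ Finset.range (m j),
        ((n.factorial : ℂ)⁻¹ * A.homBasis.repr ((A.L1 ^ n) (A.homBasis j)) i) •
          ((fun τ => A.homBasis.repr (f τ) j) * h ^ n) := by
    funext τ
    conv_lhs => rw [← A.sum_homBasis_repr_of_mem_trunc (hf.mem_trunc τ)]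
    simp only [map_sum, map_smul, Finsupp.coe_finsetSum, Finset.sum_apply, Finsupp.smul_apply,
      Pi.smul_apply, Pi.mul_apply, Pi.pow_apply, smul_eq_mul]
    refine Finset.sum_congr rfl fun j _ => ?_
    rw [A.expL1_apply_eq_sum _ (hm j)]
    simp only [map_sum, map_smul, Finsupp.coe_finsetSum, Finset.sum_apply, Finsupp.smul_apply,
      smul_eq_mul, Finset.mul_sum]
    refine Finset.sum_congr rfl fun n _ => ?_
    ring
  rw [h1]
  exact Subalgebra.sum_mem _ fun j _ => Subalgebra.sum_mem _ fun n _ =>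
    cuspHolomorphic.smul_mem (mul_mem (hf'.2 j) (pow_mem hh n)) _

/-- The coordinates of `exp (-e L(1)) f` in a homogeneous basis, where `e` is the scaled Eisenstein
series of weight `2`. -/
def untwistCoord (i : A.BasisIndex) : (UpperHalfPlane → V) →ₗ[ℂ] (UpperHalfPlane → ℂ) where
  toFun f τ := A.homBasis.repr (A.expL1 (-scaledE2 τ) (f τ)) i
  map_add' f g := by funext τ; simp
  map_smul' c f := by funext τ; simp

theorem untwistCoord_apply (i : A.BasisIndex) (f : UpperHalfPlane → V) (τ : UpperHalfPlane) :
    A.untwistCoord i f τ = A.homBasis.repr (A.expL1 (-scaledE2 τ) (f τ)) i := rfl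

theorem eq_of_untwistCoord_eq {f g : UpperHalfPlane → V} {τ : UpperHalfPlane}
    (h : ∀ i, A.untwistCoord i f τ = A.untwistCoord i g τ) : f τ = g τ := by
  have h1 : A.expL1 (-scaledE2 τ) (f τ) = A.expL1 (-scaledE2 τ) (g τ) := A.homBasis.ext_elem h
  rw [← A.expL1_cancel_neg (scaledE2 τ) (f τ), h1, A.expL1_cancel_neg]

theorem untwistCoord_expL1 (i : A.BasisIndex) (f : UpperHalfPlane → V) (τ : UpperHalfPlane) :
    A.untwistCoord i (fun τ => A.expL1 (scaledE2 τ) (f τ)) τ = A.homBasis.repr (f τ) i := by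
  rw [untwistCoord_apply, A.expL1_neg_cancel]

/-- The untwisting turns the slash operator into scalar slash operators. -/
theorem untwistCoord_slash (k : ℤ) (f : UpperHalfPlane → V) (γ : SL2Z) (τ : UpperHalfPlane)
    (i : A.BasisIndex) :
    A.untwistCoord i (A.slash k f γ) τ =
      autFactor γ τ ^ (-(k - 2 * i.1)) * A.untwistCoord i f (γ • τ) := by
  have hj := autFactor_ne_zero γ τ
  set j := autFactor γ τ with hjdef
  have h1 : A.slash k f γ τ = j ^ (-k) • A.diag (fun n => j ^ (2 * n))
      (A.expL1 ((γ 1 0 : ℂ) * j) (f (γ • τ))) := rfl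
  -- The transformation of e in the form c j = j² e(τ) - e(γτ) splits the exponential; the first
  -- factor, moved past j^(2 L(0)), becomes exp(e(τ) L(1)) and is undone by the untwisting.
  have h2 : A.expL1 ((γ 1 0 : ℂ) * j) (f (γ • τ)) =
      A.expL1 (j ^ 2 * scaledE2 τ) (A.expL1 (-scaledE2 (γ • τ)) (f (γ • τ))) := by
    rw [scaledE2_smul, ← Module.End.mul_apply, A.expL1_mul]
    congr 2
    ring
  rw [untwistCoord_apply, h1, h2, A.diag_expL1 hj, map_smul, A.expL1_neg_cancel, map_smul,
    Finsupp.smul_apply, A.homBasis_repr_diag, ← untwistCoord_apply, smul_eq_mul, ← mul_assoc,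
    ← zpow_add₀ hj]
  congr 2
  ring

/-- A `V`-valued function is quasi-modular of depth at most `s` if and only if its untwisted
coordinates are, with weights shifted by the degrees. -/
theorem exists_isQuasiModular_iff {k : ℤ} {s : ℕ} {f : UpperHalfPlane → V} :
    (∃ N Q, A.IsQuasiModular k s N f Q) ↔
      (∃ N, ∀ τ, f τ ∈ A.trunc N) ∧ ∀ i, A.untwistCoord i f ∈ scalarQuasi (k - 2 * i.1) s := by
  constructor
  · rintro ⟨N, Q, h⟩
    refine ⟨⟨N, h.form.mem_trunc⟩, fun i =>
      -- The scalar notion constrains the coefficients at every index, the vector-valued one only up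
      -- to s; hence the extension by zero.
      ⟨fun n => if n ≤ s then A.untwistCoord i (Q n) else 0, fun n => ?_, fun γ τ => ?_⟩⟩
    · split_ifs with hn
      · exact (isHolomorphicForm_iff.mp ((h.coeff n hn).expL1 (neg_mem scaledE2_mem))).2 i
      · exact zero_mem _
    · rw [← untwistCoord_slash, untwistCoord_apply, h.slash_eq]
      simp only [map_sum, map_smul, Finsupp.coe_finsetSum, Finset.sum_apply, Finsupp.smul_apply,
        smul_eq_mul]
      refine Finset.sum_congr rfl fun n hn => ?_
      rw [if_pos (Nat.lt_succ_iff.mp (Finset.mem_range.mp hn)), untwistCoord_apply]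
  · rintro ⟨⟨N, hN⟩, h⟩
    choose Q hQ using h
    let S := (A.finite_basisIndex_le N).toFinset
    have hrepr : ∀ (c : A.BasisIndex → ℂ) (i : A.BasisIndex),
        A.homBasis.repr (∑ j ∈ S, c j • A.homBasis j) i = if i.1 ≤ N then c i else 0 := by
      intro c i
      simp only [map_sum, map_smul, Finsupp.coe_finsetSum, Finset.sum_apply, Finsupp.smul_apply,
        Module.Basis.repr_self, smul_eq_mul, Finsupp.single_apply, mul_ite, mul_one, mul_zero,
        Finset.sum_ite_eq']
      simp [S]
    have htrunc : ∀ c : A.BasisIndex → ℂ, ∑ j ∈ S, c j • A.homBasis j ∈ A.trunc N := fun c =>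
      A.mem_trunc_iff.mpr fun i hi => by rw [hrepr, if_neg (not_le.mpr hi)]
    have hzero : ∀ (i : A.BasisIndex) (τ : UpperHalfPlane), ¬ i.1 ≤ N → A.untwistCoord i f τ = 0 :=
      fun i τ hi => A.mem_trunc_iff.mp (A.expL1_mem_trunc _ (hN τ)) i (not_le.mp hi)
    have hform : A.IsHolomorphicForm N f := by
      have h1 : A.IsHolomorphicForm N fun τ => A.expL1 (-scaledE2 τ) (f τ) :=
        isHolomorphicForm_iff.mpr ⟨fun τ => A.expL1_mem_trunc _ (hN τ), fun i => (hQ i).mem⟩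
      have h2 := h1.expL1 scaledE2_mem
      simpa only [A.expL1_cancel_neg] using h2
    -- The coefficient functions are assembled from the scalar ones in degrees at most N and twisted
    -- back. Higher degrees may be dropped because the coordinates of f vanish there.
    refine ⟨N, fun n τ => A.expL1 (scaledE2 τ) (∑ j ∈ S, Q j n τ • A.homBasis j), hform,
      fun n _ => ?_, fun γ τ => ?_⟩
    · refine IsHolomorphicForm.expL1 (isHolomorphicForm_iff.mpr ⟨fun τ => htrunc _, fun i => ?_⟩)
        scaledE2_mem
      simp only [hrepr]
      split_ifs
      · exact (hQ i).coeff n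
      · exact zero_mem _
    · refine A.eq_of_untwistCoord_eq (g := fun τ => ∑ n ∈ Finset.range (s + 1), autX γ τ ^ n •
        A.expL1 (scaledE2 τ) (∑ j ∈ S, Q j n τ • A.homBasis j)) fun i => ?_
      rw [untwistCoord_slash, untwistCoord_apply A i (fun τ => _) τ]
      simp only [← map_smul, ← map_sum (A.expL1 _), A.expL1_neg_cancel]
      have hsum : ∀ v : ℕ → V,
          A.homBasis.repr (∑ n ∈ Finset.range (s + 1), autX γ τ ^ n • v n) i =
            ∑ n ∈ Finset.range (s + 1), autX γ τ ^ n * A.homBasis.repr (v n) i := by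
        intro v
        simp
      simp only [hsum, hrepr]
      split_ifs with hi
      · exact (hQ i).slash_eq γ τ
      · simp [hzero i _ hi]

end QVOA

/-! ### Reduction of the dimensions to scalar forms -/

namespace QVOA

variable {V : Type*} [AddCommGroup V] [Module ℂ V] (A : QVOA V)

/-- Modular means quasi-modular of depth 0: then f ‖_k γ = Q_0 for every γ, and γ = 1 identifies Q_0
with f. -/
theorem mem_modularForms_iff {k : ℤ} {f : UpperHalfPlane → V} :
    f ∈ A.modularForms k ↔ (∃ N, ∀ τ, f τ ∈ A.trunc N) ∧
      ∀ i, A.untwistCoord i f ∈ scalarQuasi (k - 2 * i.1) 0 := by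
  rw [← exists_isQuasiModular_iff]
  constructor
  · rintro ⟨⟨N, hf⟩, h⟩
    exact ⟨N, fun _ => f, hf, fun _ _ => hf, fun γ τ => by simp [h γ τ]⟩
  · rintro ⟨N, Q, h⟩
    have h0 : ∀ γ τ, A.slash k f γ τ = Q 0 τ := fun γ τ => by simp [h.slash_eq γ τ]
    have h1 : ∀ τ, A.slash k f 1 τ = f τ := fun τ => by
      simp [slash, K, autFactor_one, A.expL1_zero, A.diag_one]
    exact ⟨⟨N, h.form⟩, fun γ τ => by rw [h0, ← h0 1, h1]⟩

/-- Degrees are nonnegative, so all coordinates have weight at most 2k and therefore depth at most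
k. A single depth bound thus serves all forms. -/
theorem mem_quasiModularForms_iff (hA : A.IsCFTType) {k : ℕ} {f : UpperHalfPlane → V} :
    f ∈ A.quasiModularForms (2 * k) ↔ (∃ N, ∀ τ, f τ ∈ A.trunc N) ∧
      ∀ i, A.untwistCoord i f ∈ scalarQuasi (2 * k - 2 * i.1) k := by
  rw [← exists_isQuasiModular_iff]
  constructor
  · rintro ⟨s, hs⟩
    rw [exists_isQuasiModular_iff] at hs ⊢
    refine ⟨hs.1, fun i => scalarQuasi_le_of_weight_le ?_ s (hs.2 i)⟩
    have := A.basisIndex_nonneg hA i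
    omega
  · exact fun h => ⟨k, h⟩

/-- The coordinates of the forms in a space `W` of weight `2 k` that is cut out by conditions on the
untwisted coordinates. -/
def coordMap {k s : ℕ} (W : Submodule ℂ (UpperHalfPlane → V))
    (hW : ∀ f, f ∈ W ↔ (∃ N, ∀ τ, f τ ∈ A.trunc N) ∧
      ∀ i, A.untwistCoord i f ∈ scalarQuasi (2 * k - 2 * i.1) s) :
    W →ₗ[ℂ] ∀ p : Σ n : Fin (k + 1), Fin (Module.finrank ℂ (A.deg n)),
      scalarQuasi (2 * k - 2 * (p.1 : ℕ)) s :=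
  LinearMap.pi fun p => (A.untwistCoord ⟨p.1, p.2⟩ ∘ₗ W.subtype).codRestrict _
    fun f => ((hW f).mp f.2).2 ⟨p.1, p.2⟩

/-- Coordinates of degree above k have negative weight and vanish, so the finitely many in degrees
0, …, k determine the form. Conversely, prescribed coordinates are realized by applying exp(e L(1))
to the corresponding combination of basis vectors. -/
theorem coordMap_bijective (hA : A.IsCFTType) {k s : ℕ} (W : Submodule ℂ (UpperHalfPlane → V))
    (hW : ∀ f, f ∈ W ↔ (∃ N, ∀ τ, f τ ∈ A.trunc N) ∧
      ∀ i, A.untwistCoord i f ∈ scalarQuasi (2 * k - 2 * i.1) s) :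
    Function.Bijective (A.coordMap W hW) := by
  have hneg : ∀ i : A.BasisIndex, (k : ℤ) < i.1 → scalarQuasi (2 * k - 2 * i.1) s = ⊥ :=
    fun i hi => scalarQuasi_eq_bot_of_neg (by omega) s
  constructor
  · rw [← LinearMap.ker_eq_bot, LinearMap.ker_eq_bot']
    rintro ⟨f, hf⟩ h0
    ext1
    funext τ
    refine A.eq_of_untwistCoord_eq (g := 0) fun i => ?_
    rw [map_zero, Pi.zero_apply]
    by_cases hi : i.1 ≤ k
    · obtain ⟨n, hn⟩ := Int.eq_ofNat_of_zero_le (A.basisIndex_nonneg hA i)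
      obtain ⟨i, i'⟩ := i
      obtain rfl : i = n := hn
      have hnk : n ≤ k := Int.ofNat_le.mp hi
      have h1 := congrArg Subtype.val (congrFun h0 ⟨⟨n, Nat.lt_succ_of_le hnk⟩, i'⟩)
      exact congrFun h1 τ
    · have h1 := ((hW f).mp hf).2 i
      rw [hneg i (not_le.mp hi), Submodule.mem_bot] at h1
      rw [h1, Pi.zero_apply]
  · intro c
    let v : (Σ n : Fin (k + 1), Fin (Module.finrank ℂ (A.deg n))) → A.BasisIndex :=
      fun p => ⟨p.1, p.2⟩
    have hv : Function.Injective v := by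
      rintro ⟨⟨n, hn⟩, p⟩ ⟨⟨m, hm⟩, q⟩ h
      have h1 : (n : ℤ) = m := congrArg Sigma.fst h
      obtain rfl : n = m := by exact_mod_cast h1
      have h2 := eq_of_heq (Sigma.mk.inj h).2
      exact congrArg (Sigma.mk _) h2
    let g : UpperHalfPlane → V := fun τ => ∑ p, (c p).1 τ • A.homBasis (v p)
    have hg : ∀ i τ, A.untwistCoord i (fun τ => A.expL1 (scaledE2 τ) (g τ)) τ =
        ∑ p, (c p).1 τ * (if v p = i then 1 else 0) := by
      intro i τ
      rw [untwistCoord_expL1]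
      simp [g, Finsupp.single_apply]
    have hgv : ∀ p, A.untwistCoord (v p) (fun τ => A.expL1 (scaledE2 τ) (g τ)) = (c p).1 := by
      intro p
      funext τ
      rw [hg, Finset.sum_eq_single p]
      · simp
      · intro q _ hq
        simp [hv.ne hq]
      · simp
    have hmem : (fun τ => A.expL1 (scaledE2 τ) (g τ)) ∈ W := by
      refine (hW _).mpr ⟨⟨k, fun τ => A.expL1_mem_trunc _ (Submodule.sum_mem _ fun p _ =>
        Submodule.smul_mem _ _ (A.deg_le_trunc ?_ (A.homBasis_mem (v p))))⟩, fun i => ?_⟩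
      · have := p.1.2
        simp only [v]
        omega
      · by_cases hi : ∃ p, v p = i
        · obtain ⟨p, rfl⟩ := hi
          rw [hgv]
          exact (c p).2
        · have h0 : A.untwistCoord i (fun τ => A.expL1 (scaledE2 τ) (g τ)) = 0 := by
            funext τ
            rw [hg]
            exact Finset.sum_eq_zero fun p _ => by rw [if_neg fun h => hi ⟨p, h⟩, mul_zero]
          rw [h0]
          exact zero_mem _
    refine ⟨⟨_, hmem⟩, ?_⟩
    funext p
    ext1
    exact hgv p

theorem finiteDimensional_and_finrank (hA : A.IsCFTType) {k s : ℕ}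
    (W : Submodule ℂ (UpperHalfPlane → V))
    (hW : ∀ f, f ∈ W ↔ (∃ N, ∀ τ, f τ ∈ A.trunc N) ∧
      ∀ i, A.untwistCoord i f ∈ scalarQuasi (2 * k - 2 * i.1) s) :
    FiniteDimensional ℂ W ∧ Module.finrank ℂ W =
      ∑ n ∈ Finset.range (k + 1), Module.finrank ℂ (A.deg n) *
        Module.finrank ℂ (scalarQuasi (2 * (k - n : ℕ)) s) := by
  let e := LinearEquiv.ofBijective _ (A.coordMap_bijective hA W hW)
  refine ⟨e.symm.finiteDimensional, ?_⟩
  rw [e.finrank_eq, Module.finrank_pi_fintype, Fintype.sum_sigma, ← Fin.sum_univ_eq_sum_range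
    (fun n => Module.finrank ℂ (A.deg n) * Module.finrank ℂ (scalarQuasi (2 * (k - n : ℕ)) s))]
  refine Finset.sum_congr rfl fun n _ => ?_
  rw [Nat.cast_sub (Nat.lt_succ_iff.mp n.2), mul_sub]
  change ∑ _ : Fin (Module.finrank ℂ (A.deg n)),
    Module.finrank ℂ (scalarQuasi (2 * k - 2 * (n : ℕ)) s) = _
  rw [Fin.sum_const, smul_eq_mul]

end QVOA

/-! ### Generating functions -/

/-- The dimension of the space of scalar modular forms of weight `2 i`. -/
def scalarModularDim (i : ℕ) : ℕ := Module.finrank ℂ (scalarQuasi (2 * i) 0)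

/-- The summands e^i M_{2j-2i} with i > j have negative weight and contribute nothing; reversing the
order of the others gives a partial sum independent of s. -/
theorem finrank_scalarQuasi_even {j s : ℕ} (h : j ≤ s) :
    Module.finrank ℂ (scalarQuasi (2 * j) s) = ∑ i ∈ Finset.range (j + 1), scalarModularDim i := by
  rw [finrank_scalarQuasi_eq_sum, ← Finset.sum_subset (Finset.range_mono (Nat.add_le_add_right h 1)),
    ← Finset.sum_range_reflect scalarModularDim]
  · refine Finset.sum_congr rfl fun i hi => ?_
    have : i ≤ j := Nat.lt_succ_iff.mp (Finset.mem_range.mp hi)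
    rw [scalarModularDim, Nat.add_sub_cancel, Nat.cast_sub this, mul_sub]
  · intro i _ hi
    refine finrank_scalarQuasi_zero_of_neg ?_
    have : ¬ i < j + 1 := fun h => hi (Finset.mem_range.mpr h)
    omega

open PowerSeries in
-- Comparing coefficients leaves the recursion m(n) + m(n-5) = m(n-2) + m(n-3) + δ(n,0), which
-- follows from the explicit dimension formula by arithmetic modulo 6.
theorem mk_scalarModularDim_mul :
    (mk fun i => (scalarModularDim i : ℚ)) * ((1 - X ^ 2) * (1 - X ^ 3)) = 1 := by
  have h : ((1 - X ^ 2) * (1 - X ^ 3) : ℚ⟦X⟧) = 1 - X ^ 2 - X ^ 3 + X ^ 5 := by ring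
  rw [h]
  ext n
  simp only [mul_add, mul_sub, mul_one, map_add, map_sub, coeff_mul_X_pow', coeff_mk, coeff_one]
  have key : scalarModularDim n + (if 5 ≤ n then scalarModularDim (n - 5) else 0) =
      (if 2 ≤ n then scalarModularDim (n - 2) else 0) +
      (if 3 ≤ n then scalarModularDim (n - 3) else 0) + if n = 0 then 1 else 0 := by
    simp only [scalarModularDim, finrank_scalarQuasi_zero]
    split_ifs <;> omega
  have key' := congrArg (Nat.cast : ℕ → ℚ) key
  push_cast at key'
  linear_combination key'

open PowerSeries in
theorem mk_sum_range_mul_one_sub_X (a : ℕ → ℚ) :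
    (mk fun n => ∑ i ∈ Finset.range (n + 1), a i) * (1 - X) = mk a := by
  ext n
  cases n with
  | zero => simp [mul_sub]
  | succ n => simp [mul_sub, coeff_succ_mul_X, Finset.sum_range_succ _ (n + 1)]

open PowerSeries in
theorem mk_sum_range_mul (a b : ℕ → ℚ) :
    (mk fun n => ∑ i ∈ Finset.range (n + 1), a i * b (n - i)) = mk a * mk b := by
  ext n
  rw [coeff_mul, Finset.Nat.sum_antidiagonal_eq_sum_range_succ_mk]
  simp

theorem QVOA.gradedDim_eq {V : Type*} [AddCommGroup V] [Module ℂ V] (A : QVOA V)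
    (hA : A.IsCFTType) : A.gradedDim = HahnSeries.ofPowerSeries ℤ ℚ
      (PowerSeries.mk fun n => (Module.finrank ℂ (A.deg n) : ℚ)) := by
  ext n
  rcases le_or_gt 0 n with hn | hn
  · lift n to ℕ using hn
    rw [HahnSeries.ofPowerSeries_apply_coeff, PowerSeries.coeff_mk]
    rfl
  · have h1 : A.gradedDim.coeff n = Module.finrank ℂ (A.deg n) := rfl
    rw [h1, A.deg_eq_bot_of_neg hA hn, finrank_bot, Nat.cast_zero,
      HahnSeries.ofPowerSeries_apply, HahnSeries.embDomain_of_notMem_range]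
    rintro ⟨m, hm⟩
    have : (m : ℤ) = n := hm
    omega

end

/-! ### The two generating functions and the first differences -/

theorem mainTheorem10 {V : Type*} [AddCommGroup V] [Module ℂ V] (A : QVOA V)
    (hA : A.IsCFTType) :
    (∀ k : ℕ, FiniteDimensional ℂ (A.quasiModularForms (2 * k)) ∧
      FiniteDimensional ℂ (A.modularForms (2 * k))) ∧
    HahnSeries.ofPowerSeries ℤ ℚ
        (PowerSeries.mk fun k => (Module.finrank ℂ (A.quasiModularForms (2 * k)) : ℚ)) =
      A.gradedDim / ((1 - qVar) * (1 - qVar ^ 2) * (1 - qVar ^ 3)) ∧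
    HahnSeries.ofPowerSeries ℤ ℚ
        (PowerSeries.mk fun k => (Module.finrank ℂ (A.modularForms (2 * k)) : ℚ)) =
      A.gradedDim / ((1 - qVar ^ 2) * (1 - qVar ^ 3)) ∧
    Module.finrank ℂ (A.modularForms 0) = Module.finrank ℂ (A.quasiModularForms 0) ∧
    ∀ k : ℕ, (Module.finrank ℂ (A.modularForms (2 * (k + 1))) : ℤ) =
      Module.finrank ℂ (A.quasiModularForms (2 * (k + 1))) -
        Module.finrank ℂ (A.quasiModularForms (2 * k)) := by
  have hQ := fun k : ℕ => A.finiteDimensional_and_finrank hA (A.quasiModularForms (2 * k))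
    fun _ => A.mem_quasiModularForms_iff hA
  have hM := fun k : ℕ => A.finiteDimensional_and_finrank hA (A.modularForms (2 * k))
    fun _ => A.mem_modularForms_iff
  let d : ℕ → ℚ := fun n => Module.finrank ℂ (A.deg n)
  let m : ℕ → ℚ := fun n => scalarModularDim n
  let Q := PowerSeries.mk fun k : ℕ => (Module.finrank ℂ (A.quasiModularForms (2 * k)) : ℚ)
  let M := PowerSeries.mk fun k : ℕ => (Module.finrank ℂ (A.modularForms (2 * k)) : ℚ)
  have hMd : M = PowerSeries.mk d * PowerSeries.mk m := by
    rw [← mk_sum_range_mul]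
    ext k
    simp only [M, PowerSeries.coeff_mk, (hM k).2, d, m, scalarModularDim]
    push_cast
    rfl
  have hQd : Q = PowerSeries.mk d *
      PowerSeries.mk fun n => ∑ i ∈ Finset.range (n + 1), m i := by
    rw [← mk_sum_range_mul]
    ext k
    simp only [Q, PowerSeries.coeff_mk, (hQ k).2, d, m]
    rw [Nat.cast_sum]
    refine Finset.sum_congr rfl fun n _ => ?_
    rw [finrank_scalarQuasi_even (Nat.sub_le k n)]
    push_cast
    rfl
  -- Multiplication by 1 - q undoes the partial sums. Both the extra factor in the first series and
  -- the difference formulas come from this identity.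
  have hQM : Q * (1 - PowerSeries.X) = M := by
    rw [hQd, hMd, mul_assoc, mk_sum_range_mul_one_sub_X]
  have hq : qVar = HahnSeries.ofPowerSeries ℤ ℚ PowerSeries.X := HahnSeries.ofPowerSeries_X.symm
  have hMX : M * ((1 - PowerSeries.X ^ 2) * (1 - PowerSeries.X ^ 3)) = PowerSeries.mk d := by
    rw [hMd, mul_assoc, mk_scalarModularDim_mul, mul_one]
  have hne : (1 - PowerSeries.X ^ 2) * (1 - PowerSeries.X ^ 3) ≠ (0 : PowerSeries ℚ) := by
    intro h
    simpa [h] using mk_scalarModularDim_mul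
  have hne1 : (1 - PowerSeries.X) ≠ (0 : PowerSeries ℚ) := by
    intro h
    simpa using congrArg (PowerSeries.coeff 0) h
  have hinj := HahnSeries.ofPowerSeries_injective (Γ := ℤ) (R := ℚ)
  refine ⟨fun k => ⟨(hQ k).1, (hM k).1⟩, ?_, ?_, ?_, ?_⟩
  · have h : (1 - qVar) * (1 - qVar ^ 2) * (1 - qVar ^ 3) = HahnSeries.ofPowerSeries ℤ ℚ
        ((1 - PowerSeries.X) * ((1 - PowerSeries.X ^ 2) * (1 - PowerSeries.X ^ 3))) := by
      simp only [hq, map_mul, map_sub, map_one, map_pow, mul_assoc]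
    rw [h, A.gradedDim_eq hA, eq_div_iff, ← map_mul]
    · change HahnSeries.ofPowerSeries ℤ ℚ (Q * _) = HahnSeries.ofPowerSeries ℤ ℚ (PowerSeries.mk d)
      rw [← mul_assoc, hQM, hMX]
    · rw [Ne, map_eq_zero_iff _ hinj]
      exact mul_ne_zero hne1 hne
  · have h : (1 - qVar ^ 2) * (1 - qVar ^ 3) = HahnSeries.ofPowerSeries ℤ ℚ
        ((1 - PowerSeries.X ^ 2) * (1 - PowerSeries.X ^ 3)) := by
      simp only [hq, map_mul, map_sub, map_one, map_pow]
    rw [h, A.gradedDim_eq hA, eq_div_iff, ← map_mul]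
    · change HahnSeries.ofPowerSeries ℤ ℚ (M * _) = HahnSeries.ofPowerSeries ℤ ℚ (PowerSeries.mk d)
      rw [hMX]
    · rwa [Ne, map_eq_zero_iff _ hinj]
  · have h := congrArg (PowerSeries.coeff 0) hQM
    simp only [mul_sub, mul_one, map_sub, PowerSeries.coeff_zero_mul_X, sub_zero, Q, M,
      PowerSeries.coeff_mk] at h
    exact_mod_cast h.symm
  · intro k
    have h := congrArg (PowerSeries.coeff (k + 1)) hQM
    simp only [mul_sub, mul_one, map_sub, PowerSeries.coeff_succ_mul_X, Q, M,
      PowerSeries.coeff_mk] at h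
    exact_mod_cast h.symm
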